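/- Let $H$ be a real Hilbert space, $\mathsf A:H\to 2^H$ a maximal monotone operator, $S=\mathsf A^{-1}(0)$ its set of zeros, and $J_\sigma=(I+\sigma\mathsf A)^{-1}$ ($\sigma>0$) its resolvent functions. Let $u,y_0\in H$, $(c_n)\subset(0,\infty)$, $(\lambda_n),(\delta_n)\subset(0,1)$, $(\gamma_n)\subset[0,1)$ with $\lambda_n+\gamma_n+\delta_n=1$, and $$y_{n+1}=\lambda_n u+\gamma_n y_n+\delta_n J_{c_n}(y_n)\qquad(n\in\mathbb N).$$ Let $c\in\mathbb N\setminus\{0\}$ and let $\ell,L:\mathbb N\to\mathbb N$, $h:\mathbb N\to\mathbb N\setminus\{0\}$ be monotone (that is, nondecreasing) functions such that for all $k,n\in\mathbb N$ $$\lambda_n\ge\tfrac1{h(n)},\qquad \lambda_m\le\tfrac1{k+1}\ \text{ for all } m\ge\ell(k),\qquad \sum_{i=1}^{L(k)}\lambda_i\ge k,\qquad \min\{c_n,\delta_n^2\}\ge\tfrac1c .$$ Let $\mathsf C:\mathbb N\to\mathbb N$ be monotone with $c_n\le\mathsf C(n)$ for all $n$, and let $D\in\mathbb N\setminus\{0\}$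 satisfy $D\ge\max\{2\|u-p\|,\|y_0-p\|\}$ for some $p\in S$. Write $J:=J_{1/c}$. Then for all $k\in\mathbb N$ and all monotone $f:\mathbb N\to\mathbb N$: (i) there is $n\le\widetilde\mu(k,f)$ such that $\|J_{c_i}(y_i)-y_i\|\le\frac1{k+1}$ for all integers $i\in[n,f(n)]$; (ii) there is $n\le\widetilde\mu(2k+1,f)$ such that $\|J(y_i)-y_i\|\le\frac1{k+1}$ for all integers $i\in[n,f(n)]$. Here $$\widetilde\mu(k,f):=\max\{\mu(16c^2(k+1)^2-1,\check f+1),\ \ell(4cD(k+1)-1)\},\qquad \check f(m):=f(\max\{m,\ell(4cD(k+1)-1)\}),$$ and $\mu$ is the following explicit functional. For $k\in\mathbb N$ and $f:\mathbb N\to\mathbb N$ put (with $g^{(j)}$ the $j$-th iterate of $g$) - $\zeta(j,n):=c(j+1)\mathsf C(n)-1$, $\quad\overline\sigma(k,n):=L(n+\lceil\ln(12D^2(k+1))\rceil)+1$, $\quad\widetilde f(n):=f(\overline\sigma(k,n))$; - $\phi_2(j,n,g):=\max\{n,g^{(4D^2(j+1))}(n)\}$, $\quad\phi_1(j,n,g):=g(\phi_2(j,n,g))$;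 - $r_1(n):=12c(n+1)^2-1$, $\quad r_2(n):=\max\{2(n+1),128D(k+1)^2\}$; - $r_3(n):=\ell(\max\{96cD^2(n+1)^2-1,\ 256D^2(k+1)^2-1,\ 16c\,r_2(n)^2D^2\})$; - $r_4(n):=3(k+1)\big(\widetilde f(\phi_2(r_1(n),r_3(n),\widetilde f+2))+1\big)$, $\quad\Phi(n):=\phi_1(r_1(n),r_3(n),\widetilde f+2)$; - $\Xi_1(n):=\zeta\big(2(6D+1)\max\{r_1(n),r_4(n)\}-1,\ \Phi(n)\big)$; - $\xi(n):=\zeta\big(\max\{16h(f(n))(k+1)^2(6D+1),\ 4c\,r_2(n)^2(6D+1)\},\ f(n)\big)$; - $\Xi(n):=\max\{\Xi_1(n),\xi(\Phi(n))\}$; - $w_g(m):=\max\{g(24D(m+1)^2),24D(m+1)^2\}$, $\quad\beta(j,g):=24D\big(w_g^{(R)}(0)+1\big)^2$ with $R:=4D^4(j+1)^2$. Then, with $b:=\beta(32(k+1)^2-1,\Xi)$, $$\mu(k,f):=\max\{\overline\sigma(k,\phi_2(r_1(b),r_3(b),\widetilde f+2)),\ \Phi(b)\}.$$ -/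

import Mathlib

namespace MultiPPA

section Operators

variable {H : Type*} [NormedAddCommGroup H] [InnerProductSpace ℝ H]

/-- A set-valued operator `A : H → 2^H` is monotone: `⟪x - x', y - y'⟫ ≥ 0` for all
`(x, y)`, `(x', y')` in its graph. -/
def IsMonotoneOp (A : H → Set H) : Prop :=
  ∀ x x' y y' : H, y ∈ A x → y' ∈ A x' → 0 ≤ inner ℝ (x - x') (y - y')

/-- The graph of a set-valued operator. -/
def opGraph (A : H → Set H) : Set (H × H) := {q | q.2 ∈ A q.1}

/-- A monotone operator is maximal monotone if its graph is not properly contained in the graph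
of another monotone operator. -/
def IsMaximalMonotoneOp (A : H → Set H) : Prop :=
  IsMonotoneOp A ∧ ∀ B : H → Set H, IsMonotoneOp B → ¬ (opGraph A ⊂ opGraph B)

/-- The set `S = A⁻¹(0)` of zeros of `A`. -/
def zeroSet (A : H → Set H) : Set H := {x | (0 : H) ∈ A x}

/-- The set-valued operator `(I + σ A)⁻¹`: the set of all `y` with `x ∈ y + σ A(y)`. -/
def resolventSet (A : H → Set H) (σ : ℝ) (x : H) : Set H :=
  {y | ∃ v ∈ A y, x = y + σ • v}

open Classical in
/-- The resolvent function `J_σ = (I + σ A)⁻¹`: the element of `(I + σ A)⁻¹(x)`. For maximal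
monotone `A` on a Hilbert space and `σ > 0` that set has exactly one element for every `x`
(the value `x` is a default for the case that the set is empty, which does not occur then). -/
noncomputable def resolventFun (A : H → Set H) (σ : ℝ) (x : H) : H :=
  if hx : (resolventSet A σ x).Nonempty then hx.some else x

end Operators

/-- `ζ[c, C](k, n) = c (k + 1) C(n) - 1`. -/
def zeta (c : ℕ) (C : ℕ → ℕ) (k n : ℕ) : ℕ := c * (k + 1) * C n - 1

/-- `σ̄[L, D](k, n) = L(n + ⌈ln(12 D² (k + 1))⌉) + 1`. -/
noncomputable def sigmaBar (L : ℕ → ℕ) (D k n : ℕ) : ℕ :=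
  L (n + ⌈Real.log (12 * (D : ℝ) ^ 2 * ((k : ℝ) + 1))⌉₊) + 1

/-- `φ₂[D](k, n, f) = max {n, f^(4 D² (k + 1))(n)}` (an iterate of `f`). -/
def phi2 (D k n : ℕ) (f : ℕ → ℕ) : ℕ := max n (f^[4 * D ^ 2 * (k + 1)] n)

/-- `φ₁[D](k, n, f) = f(φ₂(k, n, f))`. -/
def phi1 (D k n : ℕ) (f : ℕ → ℕ) : ℕ := f (phi2 D k n f)

/-- `f̃(n) = f(σ̄(k, n))`. -/
noncomputable def fTilde (k : ℕ) (f L : ℕ → ℕ) (D n : ℕ) : ℕ := f (sigmaBar L D k n)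

/-- The function `f̃ + 2`. -/
noncomputable def fTilde2 (k : ℕ) (f L : ℕ → ℕ) (D n : ℕ) : ℕ := fTilde k f L D n + 2

/-- `r₁(n) = 12 c (n + 1)² - 1`. -/
def r1 (c n : ℕ) : ℕ := 12 * c * (n + 1) ^ 2 - 1

/-- `r₂(n) = max {2 (n + 1), 128 D (k + 1)²}`. -/
def r2 (k D n : ℕ) : ℕ := max (2 * (n + 1)) (128 * D * (k + 1) ^ 2)

/-- `r₃(n) = ℓ(max {96 c D² (n + 1)² - 1, 256 D² (k + 1)² - 1, 16 c r₂(n)² D²})`. -/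
def r3 (k c : ℕ) (ℓ : ℕ → ℕ) (D n : ℕ) : ℕ :=
  ℓ (max (max (96 * c * D ^ 2 * (n + 1) ^ 2 - 1) (256 * D ^ 2 * (k + 1) ^ 2 - 1))
    (16 * c * (r2 k D n) ^ 2 * D ^ 2))

/-- `r₄(n) = 3 (k + 1) (f̃(φ₂(r₁(n), r₃(n), f̃ + 2)) + 1)`. -/
noncomputable def r4 (k c : ℕ) (f ℓ : ℕ → ℕ) (D : ℕ) (L : ℕ → ℕ) (n : ℕ) : ℕ :=
  3 * (k + 1) * (fTilde k f L D (phi2 D (r1 c n) (r3 k c ℓ D n) (fTilde2 k f L D)) + 1)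

/-- `Φ(n) = φ₁(r₁(n), r₃(n), f̃ + 2)`. -/
noncomputable def Phi (k c : ℕ) (f ℓ L : ℕ → ℕ) (D n : ℕ) : ℕ :=
  phi1 D (r1 c n) (r3 k c ℓ D n) (fTilde2 k f L D)

/-- `Ξ₁(n) = ζ(2 (6 D + 1) max {r₁(n), r₄(n)} - 1, φ₁(r₁(n), r₃(n), f̃ + 2))`. -/
noncomputable def Xi1 (k : ℕ) (f : ℕ → ℕ) (c : ℕ) (C ℓ L : ℕ → ℕ) (D n : ℕ) : ℕ :=
  zeta c C (2 * (6 * D + 1) * max (r1 c n) (r4 k c f ℓ D L n) - 1)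
    (phi1 D (r1 c n) (r3 k c ℓ D n) (fTilde2 k f L D))

/-- `ξ(n) = ζ(max {16 h(f(n)) (k + 1)² (6 D + 1), 4 c r₂(n)² (6 D + 1)}, f(n))`. -/
def xi (k : ℕ) (f : ℕ → ℕ) (c : ℕ) (C : ℕ → ℕ) (D : ℕ) (h : ℕ → ℕ) (n : ℕ) : ℕ :=
  zeta c C (max (16 * h (f n) * (k + 1) ^ 2 * (6 * D + 1))
    (4 * c * (r2 k D n) ^ 2 * (6 * D + 1))) (f n)

/-- `Ξ₂(n) = ξ(Φ(n))`. -/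
noncomputable def Xi2 (k : ℕ) (f : ℕ → ℕ) (c : ℕ) (C ℓ L : ℕ → ℕ) (D : ℕ) (h : ℕ → ℕ)
    (n : ℕ) : ℕ :=
  xi k f c C D h (Phi k c f ℓ L D n)

/-- `Ξ(n) = max {Ξ₁(n), Ξ₂(n)}`. -/
noncomputable def Xi (k : ℕ) (f : ℕ → ℕ) (c : ℕ) (C ℓ L : ℕ → ℕ) (D : ℕ) (h : ℕ → ℕ)
    (n : ℕ) : ℕ :=
  max (Xi1 k f c C ℓ L D n) (Xi2 k f c C ℓ L D h n)

/-- `w_f(m) = max {f(24 D (m + 1)²), 24 D (m + 1)²}`. -/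
def wFun (D : ℕ) (f : ℕ → ℕ) (m : ℕ) : ℕ :=
  max (f (24 * D * (m + 1) ^ 2)) (24 * D * (m + 1) ^ 2)

/-- `β[D](k, f) = 24 D (w_f^(R)(0) + 1)²` with `R = 4 D⁴ (k + 1)²`. -/
def beta (D k : ℕ) (f : ℕ → ℕ) : ℕ :=
  24 * D * ((wFun D f)^[4 * D ^ 4 * (k + 1) ^ 2] 0 + 1) ^ 2

/-- `μ(k, f) = max {σ̄(k, φ₂(r₁(b), r₃(b), f̃ + 2)), Φ(b)}` with
`b = β(32 (k + 1)² - 1, Ξ)`. -/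
noncomputable def mu (c : ℕ) (C ℓ L : ℕ → ℕ) (D : ℕ) (h : ℕ → ℕ) (k : ℕ) (f : ℕ → ℕ) : ℕ :=
  let b := beta D (32 * (k + 1) ^ 2 - 1) (Xi k f c C ℓ L D h)
  max (sigmaBar L D k (phi2 D (r1 c b) (r3 k c ℓ D b) (fTilde2 k f L D)))
    (Phi k c f ℓ L D b)

/-- `f̌(m) = f(max {m, ℓ(4 c D (k + 1) - 1)})`. -/
def fCheck (c : ℕ) (ℓ : ℕ → ℕ) (D k : ℕ) (f : ℕ → ℕ) (m : ℕ) : ℕ :=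
  f (max m (ℓ (4 * c * D * (k + 1) - 1)))

/-- `μ̃(k, f) = max {μ(16 c² (k + 1)² - 1, f̌ + 1), ℓ(4 c D (k + 1) - 1)}`. -/
noncomputable def muTilde (c : ℕ) (C ℓ L : ℕ → ℕ) (D : ℕ) (h : ℕ → ℕ) (k : ℕ) (f : ℕ → ℕ) : ℕ :=
  max (mu c C ℓ L D h (16 * c ^ 2 * (k + 1) ^ 2 - 1) (fun m => fCheck c ℓ D k f m + 1))
    (ℓ (4 * c * D * (k + 1) - 1))

end MultiPPA

/-! Let z be the projection of u onto the zero set and s n = ‖y n - z‖². Firm nonexpansivity bounds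
the squared residual, up to constants, by s n - s (n+1) + O(λ n), and s satisfies s (n+1) ≤ (1 - λ
n) s n + 2 λ n ⟪u - z, y (n+1) - z⟫, where the inner product is almost nonpositive once the residual
is small. If s eventually decreases, then its decrements and the residuals tend to 0, and the
divergence of Σ λ n drives s to 0. Otherwise every later s i is dominated by some s (t+1) with s t <
s (t+1). At such t the residual is small because the decrement is negative, and dividing the
recursion by λ t bounds s (t+1). In both cases s, hence the residual, becomes small.

The finitary version replaces z by an approximate zero. `exists_approx_projection` takes z = J_T u
with T large: points of residual at most 1/(N+1) almost satisfy the variational inequality at z,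
while some a ∈ A z is as small as a prescribed function of N requires. This costs an error 3 D c_n
‖a‖ in each inequality (`isPPARecursion`). For fixed N, `exists_window` runs the dichotomy on a
finite range, and Ξ(N) encodes how small a must be there. Monotonicity of the moduli and N ≤ β then
give a bound independent of N (`max_le_mu`).

Single-valuedness plays no role, but nonemptiness of the resolvents does; it is Minty's theorem,
proved by minimizing the Fitzpatrick function plus half of the squared norm. -/

namespace MultiPPA

/-! ### Minty's theorem via the Fitzpatrick function -/

section Minty

variable {H : Type*} [NormedAddCommGroup H] [InnerProductSpace ℝ H]

/-- The epigraph of the Fitzpatrick function of a subset of `H × H`. -/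
def fitzpatrickEpi (G : Set (H × H)) : Set (H × H × ℝ) :=
  {q | ∀ g ∈ G, inner ℝ q.1 g.2 + inner ℝ g.1 q.2.1 - inner ℝ g.1 g.2 ≤ q.2.2}

/-- The Fitzpatrick function plus half of the squared norm, on the epigraph. -/
noncomputable def fitzpatrickVal (q : H × H × ℝ) : ℝ := q.2.2 + (‖q.1‖ ^ 2 + ‖q.2.1‖ ^ 2) / 2

lemma fitzpatrickEpi_lineMap {G : Set (H × H)} {q q' : H × H × ℝ} (hq : q ∈ fitzpatrickEpi G)
    (hq' : q' ∈ fitzpatrickEpi G) {t : ℝ} (h0 : 0 ≤ t) (h1 : t ≤ 1) :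
    (1 - t) • q + t • q' ∈ fitzpatrickEpi G := by
  intro g hg
  have a := mul_le_mul_of_nonneg_left (hq g hg) (sub_nonneg.2 h1)
  have b := mul_le_mul_of_nonneg_left (hq' g hg) h0
  simp only [Prod.fst_add, Prod.snd_add, Prod.smul_fst, Prod.smul_snd, inner_add_left,
    inner_add_right, real_inner_smul_left, real_inner_smul_right, smul_eq_mul]
  linarith

/-- The exact strong convexity defect in the two Hilbert coordinates. It yields both the Cauchy
property of minimizing sequences and quadratic growth at a minimizer. -/
lemma fitzpatrickVal_lineMap (q q' : H × H × ℝ) (t : ℝ) :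
    fitzpatrickVal ((1 - t) • q + t • q') = (1 - t) * fitzpatrickVal q + t * fitzpatrickVal q'
      - t * (1 - t) / 2 * (‖q.1 - q'.1‖ ^ 2 + ‖q.2.1 - q'.2.1‖ ^ 2) := by
  simp only [fitzpatrickVal, Prod.fst_add, Prod.snd_add, Prod.smul_fst, Prod.smul_snd,
    smul_eq_mul, norm_add_sq_real, norm_sub_sq_real, norm_smul, mul_pow, real_inner_smul_left,
    real_inner_smul_right, Real.norm_eq_abs, sq_abs]
  ring

lemma isClosed_fitzpatrickEpi (G : Set (H × H)) : IsClosed (fitzpatrickEpi G) := by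
  simp only [fitzpatrickEpi, Set.ofPred_forall]
  refine isClosed_iInter fun g => isClosed_iInter fun _ => isClosed_le ?_ ?_ <;> fun_prop

/-- Pointwise maximality of the graph of a monotone operator. -/
def IsMaximalGraph (G : Set (H × H)) : Prop :=
  ∀ q : H × H, q ∈ G ↔ ∀ g ∈ G, 0 ≤ inner ℝ (q.1 - g.1) (q.2 - g.2)

/-- Were the inequality to fail, the pair would be monotonically related to all of G, hence in G by
maximality; testing the epigraph condition at that very pair is then contradictory. -/
lemma IsMaximalGraph.inner_le {G : Set (H × H)} (hG : IsMaximalGraph G) {q : H × H × ℝ}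
    (hq : q ∈ fitzpatrickEpi G) : inner ℝ q.1 q.2.1 ≤ q.2.2 := by
  by_contra! hlt
  have hmem : (q.1, q.2.1) ∈ G := by
    refine (hG _).2 fun g hg => ?_
    have := hq g hg
    simp only [inner_sub_left, inner_sub_right]
    linarith
  have := hq _ hmem
  simp only at this
  linarith

lemma IsMaximalGraph.mem_fitzpatrickEpi {G : Set (H × H)} (hG : IsMaximalGraph G) {g : H × H}
    (hg : g ∈ G) : (g.1, g.2, inner ℝ g.1 g.2) ∈ fitzpatrickEpi G := by
  intro g' hg'
  have := (hG g).1 hg g' hg'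
  simp only [inner_sub_left, inner_sub_right] at this
  simp only
  linarith

lemma IsMaximalGraph.val_nonneg {G : Set (H × H)} (hG : IsMaximalGraph G) {q : H × H × ℝ}
    (hq : q ∈ fitzpatrickEpi G) : 0 ≤ fitzpatrickVal q := by
  have h1 := hG.inner_le hq
  have h2 := sq_nonneg ‖q.1 + q.2.1‖
  rw [norm_add_sq_real] at h2
  unfold fitzpatrickVal
  linarith

lemma IsMaximalGraph.exists_minimizer [CompleteSpace H] {G : Set (H × H)} (hG : IsMaximalGraph G)
    (hne : G.Nonempty) :
    ∃ q ∈ fitzpatrickEpi G, ∀ q' ∈ fitzpatrickEpi G, fitzpatrickVal q ≤ fitzpatrickVal q' := by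
  set V : Set ℝ := fitzpatrickVal '' fitzpatrickEpi G
  have hVne : V.Nonempty := by
    obtain ⟨g, hg⟩ := hne
    exact ⟨_, _, hG.mem_fitzpatrickEpi hg, rfl⟩
  have hVbd : BddBelow V := ⟨0, by rintro _ ⟨q, hq, rfl⟩; exact hG.val_nonneg hq⟩
  have hI : ∀ q ∈ fitzpatrickEpi G, sInf V ≤ fitzpatrickVal q :=
    fun q hq => csInf_le hVbd ⟨q, hq, rfl⟩
  obtain ⟨v, -, hv, hvV⟩ := exists_seq_tendsto_sInf hVne hVbd
  choose q hq hqv using hvV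
  have hdist : ∀ n m, ‖(q n).1 - (q m).1‖ ^ 2 + ‖(q n).2.1 - (q m).2.1‖ ^ 2
      ≤ 4 * ((v n - sInf V) + (v m - sInf V)) := by
    intro n m
    -- The midpoint has value at least the infimum, so the convexity defect is controlled by the
    -- excess of the two endpoints.
    have h1 := hI _ (fitzpatrickEpi_lineMap (hq n) (hq m) (t := 1 / 2) (by norm_num) (by norm_num))
    rw [fitzpatrickVal_lineMap, hqv, hqv] at h1
    linarith
  have hsmall : ∀ ε > 0, ∃ N, ∀ n ≥ N, v n - sInf V < ε := by
    intro ε hε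
    have := hv.eventually (gt_mem_nhds (show sInf V < sInf V + ε by linarith))
    obtain ⟨N, hN⟩ := Filter.eventually_atTop.1 this
    exact ⟨N, fun n hn => by linarith [hN n hn]⟩
  have hc1 : CauchySeq fun n => (q n).1 := by
    rw [Metric.cauchySeq_iff]
    intro ε hε
    obtain ⟨N, hN⟩ := hsmall (ε ^ 2 / 8) (by positivity)
    refine ⟨N, fun n hn m hm => ?_⟩
    rw [dist_eq_norm]
    refine lt_of_pow_lt_pow_left₀ 2 hε.le ?_
    nlinarith [hdist n m, hN n hn, hN m hm, sq_nonneg ‖(q n).2.1 - (q m).2.1‖]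
  have hc2 : CauchySeq fun n => (q n).2.1 := by
    rw [Metric.cauchySeq_iff]
    intro ε hε
    obtain ⟨N, hN⟩ := hsmall (ε ^ 2 / 8) (by positivity)
    refine ⟨N, fun n hn m hm => ?_⟩
    rw [dist_eq_norm]
    refine lt_of_pow_lt_pow_left₀ 2 hε.le ?_
    nlinarith [hdist n m, hN n hn, hN m hm, sq_nonneg ‖(q n).1 - (q m).1‖]
  obtain ⟨x, hx⟩ := cauchySeq_tendsto_of_complete hc1
  obtain ⟨y, hy⟩ := cauchySeq_tendsto_of_complete hc2
  -- The real coordinate is not covered by strong convexity; it is recovered from the values and the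
  -- norms.
  have hr : Filter.Tendsto (fun n => (q n).2.2) Filter.atTop
      (nhds (sInf V - (‖x‖ ^ 2 + ‖y‖ ^ 2) / 2)) := by
    have : (fun n => (q n).2.2) = fun n => v n - (‖(q n).1‖ ^ 2 + ‖(q n).2.1‖ ^ 2) / 2 := by
      funext n
      rw [← hqv n, fitzpatrickVal]
      ring
    rw [this]
    exact hv.sub (((hx.norm.pow 2).add (hy.norm.pow 2)).div_const 2)
  have hlim := hx.prodMk_nhds (hy.prodMk_nhds hr)
  refine ⟨_, (isClosed_fitzpatrickEpi G).mem_of_tendsto hlim (Filter.Eventually.of_forall hq),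
    fun q' hq' => le_trans (le_of_eq ?_) (hI q' hq')⟩
  simp [fitzpatrickVal]

/-- Let (x, y, r) be a minimizer. Its variation towards graph points shows that (-y, -x) is
monotonically related to G with surplus ‖x + y‖². So it lies in G, and testing against itself forces
x + y = 0. -/
lemma IsMaximalGraph.exists_neg_mem [CompleteSpace H] {G : Set (H × H)} (hG : IsMaximalGraph G)
    (hne : G.Nonempty) : ∃ x : H, (x, -x) ∈ G := by
  obtain ⟨q, hq, hmin⟩ := hG.exists_minimizer hne
  have hvar : ∀ g ∈ G, ‖q.1 + q.2.1‖ ^ 2 ≤ inner ℝ (-q.2.1 - g.1) (-q.1 - g.2) := by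
    intro g hg
    have hg' := hG.mem_fitzpatrickEpi hg
    set q' : H × H × ℝ := (g.1, g.2, inner ℝ g.1 g.2) with hq'
    set d := ‖q.1 - q'.1‖ ^ 2 + ‖q.2.1 - q'.2.1‖ ^ 2 with hd
    -- Quadratic growth at the minimizer: divide the inequality along the segment by t. A suitable
    -- small t replaces the limit t → 0.
    have hlin : d / 2 ≤ fitzpatrickVal q' - fitzpatrickVal q := by
      by_contra! hlt
      set s := fitzpatrickVal q' - fitzpatrickVal q with hs
      have hs0 : 0 ≤ s := sub_nonneg.2 (hmin _ hg')
      have hd0 : 0 < d := by linarith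
      have key : ∀ t : ℝ, 0 < t → t ≤ 1 → (1 - t) * (d / 2) ≤ s := by
        intro t h0 h1
        have := hmin _ (fitzpatrickEpi_lineMap hq hg' h0.le h1)
        rw [fitzpatrickVal_lineMap] at this
        have h3 : t * ((1 - t) * (d / 2)) ≤ t * s := by
          rw [hs]
          linear_combination this
        exact le_of_mul_le_mul_left h3 h0
      have := key ((d / 2 - s) / d) (div_pos (by linarith) hd0)
        ((div_le_one hd0).2 (by linarith))
      have h4 : (d / 2 - s) / d * d = d / 2 - s := div_mul_cancel₀ _ hd0.ne'
      nlinarith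
    have hle := hG.inner_le hq
    rw [hd] at hlin
    simp only [hq', fitzpatrickVal, norm_sub_sq_real, norm_add_sq_real, inner_sub_left,
      inner_sub_right, inner_neg_left, inner_neg_right, real_inner_comm] at hlin hle ⊢
    linarith
  have hmem : (-q.2.1, -q.1) ∈ G :=
    (hG _).2 fun g hg => (sq_nonneg _).trans (hvar g hg)
  have h0 := hvar _ hmem
  simp only [sub_self, inner_zero_left] at h0
  have h1 : q.1 + q.2.1 = 0 := by
    rw [← norm_eq_zero]
    exact pow_eq_zero_iff two_ne_zero |>.1 (le_antisymm h0 (sq_nonneg _))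
  refine ⟨q.1, ?_⟩
  rwa [← eq_neg_of_add_eq_zero_left h1] at hmem

lemma IsMaximalMonotoneOp.isMaximalGraph {A : H → Set H} (hA : IsMaximalMonotoneOp A) :
    IsMaximalGraph (opGraph A) := by
  rintro ⟨x, y⟩
  refine ⟨fun h g hg => hA.1 _ _ _ _ h hg, fun h => ?_⟩
  by_contra hxy
  let B : H → Set H := fun a => {b | b ∈ A a ∨ (a = x ∧ b = y)}
  refine hA.2 B ?_ ⟨fun q hq => Or.inl hq, fun hsub =>
    hxy (hsub (show (x, y) ∈ opGraph B from Or.inr ⟨rfl, rfl⟩))⟩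
  rintro a a' b b' (hb | ⟨rfl, rfl⟩) (hb' | ⟨rfl, rfl⟩)
  · exact hA.1 _ _ _ _ hb hb'
  · rw [← inner_neg_neg, neg_sub, neg_sub]
    exact h (a, b) hb
  · exact h (a', b') hb'
  · simp

/-- Minty's theorem. -/
theorem IsMaximalMonotoneOp.resolventSet_nonempty [CompleteSpace H] {A : H → Set H}
    (hA : IsMaximalMonotoneOp A) (hne : (opGraph A).Nonempty) {σ : ℝ} (hσ : 0 < σ) (x : H) :
    (resolventSet A σ x).Nonempty := by
  -- Rescaling and translating preserves maximality, and (y, -y) in this graph says σ⁻¹ (x - y) ∈ A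
  -- y.
  have hG : IsMaximalGraph {q : H × H | (q.1, σ⁻¹ • (q.2 + x)) ∈ opGraph A} := by
    intro q
    rw [Set.mem_ofPred_eq, hA.isMaximalGraph]
    constructor
    · intro h g hg
      have := h _ hg
      simp only [← smul_sub, real_inner_smul_right, add_sub_add_right_eq_sub] at this
      exact nonneg_of_mul_nonneg_right this (inv_pos.2 hσ)
    · intro h g hg
      have := h (g.1, σ • g.2 - x) (by simpa [-smul_add, smul_smul, inv_mul_cancel₀ hσ.ne'] using hg)
      have h2 : σ⁻¹ • (q.2 + x) - g.2 = σ⁻¹ • (q.2 - (σ • g.2 - x)) := by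
        rw [smul_sub, smul_sub, smul_smul, inv_mul_cancel₀ hσ.ne', smul_add, one_smul]
        abel
      simp only [h2, real_inner_smul_right]
      exact mul_nonneg (inv_pos.2 hσ).le this
  obtain ⟨g, hg⟩ := hne
  obtain ⟨y, hy⟩ := hG.exists_neg_mem
    ⟨(g.1, σ • g.2 - x), by simpa [-smul_add, smul_smul, inv_mul_cancel₀ hσ.ne'] using hg⟩
  refine ⟨y, _, hy, ?_⟩
  simp [smul_smul, mul_inv_cancel₀ hσ.ne']

theorem IsMaximalMonotoneOp.resolventFun_mem [CompleteSpace H] {A : H → Set H}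
    (hA : IsMaximalMonotoneOp A) (hne : (opGraph A).Nonempty) {σ : ℝ} (hσ : 0 < σ) (x : H) :
    resolventFun A σ x ∈ resolventSet A σ x := by
  have h := hA.resolventSet_nonempty hne hσ x
  rw [resolventFun, dif_pos h]
  exact h.some_mem

end Minty

/-! ### Approximate projection onto the zeros by resolvents with large parameter -/

section ApproximateProjection

variable {H : Type*} [NormedAddCommGroup H] [InnerProductSpace ℝ H]

/-- The second entry of the maximum in `wFun` forces this growth; it makes the resolvent parameters
below strictly increasing and eventually at least of order D (j + 1). -/
lemma wFun_iterate_lt {D : ℕ} (hD : 0 < D) (g : ℕ → ℕ) (i : ℕ) :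
    (wFun D g)^[i] 0 + D ≤ (wFun D g)^[i + 1] 0 := by
  rw [Function.iterate_succ_apply']
  set m := (wFun D g)^[i] 0
  refine le_trans ?_ (le_max_right _ _)
  nlinarith [Nat.mul_le_mul hD (Nat.zero_le m), Nat.zero_le (D * m ^ 2)]

lemma wFun_iterate_monotone {D : ℕ} (hD : 0 < D) (g : ℕ → ℕ) :
    Monotone fun i => (wFun D g)^[i] 0 :=
  monotone_nat_of_le_succ fun i => (Nat.le_add_right _ _).trans (wFun_iterate_lt hD g i)

lemma mul_le_wFun_iterate {D : ℕ} (hD : 0 < D) (g : ℕ → ℕ) (i : ℕ) :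
    D * i ≤ (wFun D g)^[i] 0 := by
  induction i with
  | zero => simp
  | succ i ih =>
    have := wFun_iterate_lt hD g i
    rw [mul_add, mul_one]
    omega

/-- Fejér-type inequality for the resolvent at `u`. -/
lemma IsMonotoneOp.norm_sq_add_le {A : H → Set H} (hA : IsMonotoneOp A) {p u z v : H}
    (hp : p ∈ zeroSet A) {σ : ℝ} (hσ : 0 < σ) (hv : v ∈ A z) (hz : u = z + σ • v) :
    ‖u - z‖ ^ 2 + ‖z - p‖ ^ 2 ≤ ‖u - p‖ ^ 2 := by
  have h1 := hA _ _ _ _ hv hp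
  rw [sub_zero] at h1
  have h2 : u - p = (u - z) + (z - p) := by abel
  have h3 : u - z = σ • v := by rw [hz]; abel
  rw [h2, norm_add_sq_real, h3, real_inner_smul_left, real_inner_comm]
  nlinarith [mul_nonneg hσ.le h1]

/-- Monotonicity gives (t' - t) ⟪z - z', v⟫ ≥ ‖z - z'‖², so u - z and z - z' form a nonobtuse pair.
Thus ‖u - J_t u‖² increases with t by at least the squared displacement. -/
lemma IsMonotoneOp.norm_sq_add_norm_sq_sub_le {A : H → Set H} (hA : IsMonotoneOp A)
    {u z v z' v' : H} {t t' : ℝ} (ht : 0 < t) (htt' : t < t') (hv : v ∈ A z)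
    (hz : u = z + t • v) (hv' : v' ∈ A z') (hz' : u = z' + t' • v') :
    ‖u - z‖ ^ 2 + ‖z - z'‖ ^ 2 ≤ ‖u - z'‖ ^ 2 := by
  have h1 := hA _ _ _ _ hv hv'
  have h2 : t' • (v - v') = (t' - t) • v - (z - z') := by
    have : t' • v' = z + t • v - z' := by rw [← hz, hz']; abel
    rw [smul_sub, this, sub_smul]
    abel
  have h3 : 0 ≤ inner ℝ (z - z') (t' • (v - v')) := by
    rw [real_inner_smul_right]
    exact mul_nonneg (ht.trans htt').le h1
  rw [h2, inner_sub_right, real_inner_smul_right, real_inner_self_eq_norm_sq] at h3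
  have h4 : 0 ≤ inner ℝ (z - z') v := by
    by_contra! h
    nlinarith [sq_nonneg ‖z - z'‖, mul_pos_of_neg_of_neg (sub_neg.2 htt') h]
  have h5 : u - z' = t • v + (z - z') := by rw [hz]; abel
  have h6 : u - z = t • v := by rw [hz]; abel
  rw [h5, h6, norm_add_sq_real, real_inner_smul_left, real_inner_comm]
  nlinarith [mul_nonneg ht.le h4]

/-- A sequence with increasing squares and total increase at most `B` has a small step. -/
lemma exists_step_le {s d : ℕ → ℝ} {B ε : ℝ} (a n : ℕ) (hs : ∀ i, s i + d i ≤ s (i + 1))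
    (h0 : ∀ i, 0 ≤ s i) (hB : ∀ i, s i ≤ B) (hn : B ≤ n * ε) (hpos : 0 < n) :
    ∃ i < n, d (a + i) ≤ ε := by
  by_contra! hlt
  have key : ∀ m ≤ n, 0 < m → m * ε < s (a + m) := by
    intro m hm hm0
    induction m with
    | zero => omega
    | succ m ih =>
      have h1 := hlt m (by omega)
      have h2 := hs (a + m)
      rw [← add_assoc]
      push_cast
      rcases Nat.eq_zero_or_pos m with rfl | hm'
      · simp only [add_zero] at *
        push_cast
        linarith [h0 a]
      · linarith [ih (by omega) hm']
  linarith [key n le_rfl hpos, hB (a + n)]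

lemma norm_sub_le_of_norm_sub_le {E : Type*} [NormedAddCommGroup E] {x z p : E} {D : ℝ}
    (hx : ‖x - p‖ ≤ D) (hz : ‖z - p‖ ≤ D / 2) :
    ‖x - z‖ ≤ 3 * D / 2 := by
  have := norm_sub_le_norm_sub_add_norm_sub x p z
  rw [norm_sub_rev p] at this
  linarith

/-- Near-zeros `x` almost satisfy the variational inequality for the resolvent `z` of `u`. -/
lemma IsMonotoneOp.inner_le_of_residual {A : H → Set H} (hA : IsMonotoneOp A)
    {u z a x x' v p : H} {t σ c D : ℝ} (hc : 0 < c) (ht : 0 < t) (ha : a ∈ A z)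
    (hz : u = z + t • a) (huz : ‖u - z‖ ≤ D / 2) (hzp : ‖z - p‖ ≤ D / 2) (hv : v ∈ A x')
    (hx : x = x' + σ • v) (hσ : 1 / c ≤ σ) (hx' : ‖x' - p‖ ≤ D) :
    inner ℝ (u - z) (x - z) ≤ D / 2 * ‖x - x'‖ + t * (c * ‖x - x'‖) * (3 * D / 2) := by
  have hσ0 : 0 < σ := lt_of_lt_of_le (by positivity) hσ
  have hvn : ‖v‖ ≤ c * ‖x - x'‖ := by
    have h2 : 1 ≤ c * σ := by
      rw [div_le_iff₀ hc] at hσ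
      linarith
    rw [hx, add_sub_cancel_left, norm_smul, Real.norm_eq_abs, abs_of_pos hσ0]
    nlinarith [norm_nonneg v]
  have b1 : inner ℝ (u - z) (x - x') ≤ D / 2 * ‖x - x'‖ :=
    (real_inner_le_norm _ _).trans (by gcongr)
  have h1 : u - z = t • a := by
    rw [sub_eq_iff_eq_add, add_comm]; exact hz
  have h2 := hA _ _ _ _ hv ha
  rw [inner_sub_right] at h2
  have h3 : inner ℝ (x' - z) v ≤ 3 * D / 2 * (c * ‖x - x'‖) :=
    (real_inner_le_norm _ _).trans (mul_le_mul (norm_sub_le_of_norm_sub_le hx' hzp) hvn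
      (norm_nonneg _) ((norm_nonneg _).trans (norm_sub_le_of_norm_sub_le hx' hzp)))
  -- Monotonicity replaces a by v, whose norm is controlled by the residual.
  have b2 : inner ℝ (u - z) (x' - z) ≤ t * (c * ‖x - x'‖) * (3 * D / 2) := by
    rw [h1, real_inner_smul_left, real_inner_comm, mul_assoc]
    refine mul_le_mul_of_nonneg_left ?_ ht.le
    linarith
  have hdecomp : inner ℝ (u - z) (x - z) =
      inner ℝ (u - z) (x - x') + inner ℝ (u - z) (x' - z) := by
    rw [← inner_add_right, sub_add_sub_cancel]
  linarith

/-- The variational inequality is stable under a change of its base point. -/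
lemma inner_sub_le_of_norm_sub_le {u x z z' p : H} {D ε : ℝ} (huz : ‖u - z‖ ≤ D / 2)
    (hzp : ‖z' - p‖ ≤ D / 2) (hx : ‖x - p‖ ≤ D) (hzz : ‖z - z'‖ ≤ ε) :
    inner ℝ (u - z') (x - z') ≤ inner ℝ (u - z) (x - z) + 2 * D * ε := by
  have hε : 0 ≤ ε := (norm_nonneg _).trans hzz
  have hD : 0 ≤ D := (norm_nonneg _).trans hx
  have b3 : inner ℝ (z - z') (x - z') ≤ ε * (3 * D / 2) :=
    (real_inner_le_norm _ _).trans
      (mul_le_mul hzz (norm_sub_le_of_norm_sub_le hx hzp) (norm_nonneg _) hε)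
  have b4 : inner ℝ (u - z) (z - z') ≤ D / 2 * ε :=
    (real_inner_le_norm _ _).trans (mul_le_mul huz hzz (norm_nonneg _) (by linarith))
  have hdecomp : inner ℝ (u - z') (x - z') = inner ℝ (u - z) (x - z) +
      inner ℝ (z - z') (x - z') + inner ℝ (u - z) (z - z') := by
    simp only [inner_sub_left, inner_sub_right]
    ring
  linarith

/-- The tolerance is quadratic in M: one factor absorbs the resolvent parameter, the other the
accuracy D * j. Only a quarter of the allowed error is spent, leaving three quarters for the change
of base point. -/
lemma approx_projection_bound {D M ρ j : ℝ} (hD : 1 ≤ D) (hM : 1 ≤ M) (hρ0 : 0 ≤ ρ) (hj : 0 < j)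
    (hMj : D * j ≤ M) (hρ : ρ ≤ 1 / (24 * D * M ^ 2 + 1)) :
    D / 2 * ρ + D * M / 2 * ρ * (3 * D / 2) ≤ 1 / (4 * j) := by
  have hD0 : 0 < D := by linarith
  have hM0 : 0 < M := by linarith
  have h1 : ρ * (24 * D * M ^ 2) ≤ 1 := by
    rw [le_div_iff₀ (by positivity)] at hρ
    linarith
  rw [le_div_iff₀ (by positivity)]
  have h3 : D / 2 * ρ + D * M / 2 * ρ * (3 * D / 2) ≤ 5 / 4 * (D * M * D * ρ) := by
    have : D * ρ * 1 ≤ D * ρ * (D * M) :=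
      mul_le_mul_of_nonneg_left (one_le_mul_of_one_le_of_one_le hD hM) (by positivity)
    linarith
  calc _ ≤ (5 / 4 * (D * M * D * ρ)) * (4 * j) := mul_le_mul_of_nonneg_right h3 (by positivity)
    _ = 5 * (D * M * ρ) * (D * j) := by ring
    _ ≤ 5 * (D * M * ρ) * M := mul_le_mul_of_nonneg_left hMj (by positivity)
    _ ≤ 1 := by linarith

/-- A quantitative version of the projection of `u` onto the set of zeros. -/
theorem exists_approx_projection [CompleteSpace H] {A : H → Set H} (hA : IsMaximalMonotoneOp A)
    {p u : H} (hp : p ∈ zeroSet A) {c D : ℕ} (hc : 0 < c) (hD : 0 < D)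
    (hup : ‖u - p‖ ≤ D / 2) (j : ℕ) (g : ℕ → ℕ) :
    ∃ N ≤ beta D j g, ∃ z, ∃ a ∈ A z, ‖a‖ ≤ c / ((g N : ℝ) + 1) ∧ ‖u - z‖ ≤ D / 2 ∧
      ‖z - p‖ ≤ D / 2 ∧ ∀ x x' v : H, ∀ σ : ℝ, v ∈ A x' → x = x' + σ • v → 1 / (c : ℝ) ≤ σ →
        ‖x - p‖ ≤ D → ‖x' - p‖ ≤ D → ‖x - x'‖ ≤ 1 / ((N : ℝ) + 1) →
        inner ℝ (u - z) (x - z) ≤ 1 / ((j : ℝ) + 1) := by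
  have hc' : (0 : ℝ) < c := by exact_mod_cast hc
  have hD' : (0 : ℝ) < D := by exact_mod_cast hD
  have hD1 : (1 : ℝ) ≤ D := by exact_mod_cast hD
  set m : ℕ → ℕ := fun i => (wFun D g)^[i] 0 with hm
  -- Chosen so that T i * ‖V i‖ = ‖u - Z i‖ ≤ D / 2 becomes ‖V i‖ ≤ c / (m i + 1).
  set T : ℕ → ℝ := fun i => D * ((m i : ℝ) + 1) / (2 * c) with hT
  have hTpos : ∀ i, 0 < T i := fun i => by positivity
  have hTlt : ∀ i, T i < T (i + 1) := by
    intro i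
    have h1 : m i + 1 ≤ m (i + 1) :=
      (Nat.add_le_add_left hD _).trans (wFun_iterate_lt hD g i)
    have h2 : (m i : ℝ) + 1 ≤ m (i + 1) := by exact_mod_cast h1
    simp only [hT]
    gcongr
    linarith
  have hex := fun i => hA.resolventSet_nonempty ⟨(p, 0), hp⟩ (hTpos i) u
  choose Z V hV hZ using hex
  have hF := fun i => hA.1.norm_sq_add_le hp (hTpos i) (hV i) (hZ i)
  have hup2 : ‖u - p‖ ^ 2 ≤ (D / 2 : ℝ) ^ 2 := pow_le_pow_left₀ (norm_nonneg _) hup 2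
  have huZ : ∀ i, ‖u - Z i‖ ≤ D / 2 := fun i =>
    le_of_sq_le_sq (by nlinarith [hF i, sq_nonneg ‖Z i - p‖]) (by positivity)
  have hZp : ∀ i, ‖Z i - p‖ ≤ D / 2 := fun i =>
    le_of_sq_le_sq (by nlinarith [hF i, sq_nonneg ‖u - Z i‖]) (by positivity)
  -- Starting at j + 1 guarantees D (j + 1) ≤ m n, and the search still ends within the number R of
  -- iterates in `beta`. The step size is three quarters of 1 / (j + 1) divided by 2 D.
  obtain ⟨i, hi, hstep⟩ := exists_step_le (s := fun i => ‖u - Z i‖ ^ 2)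
    (d := fun i => ‖Z i - Z (i + 1)‖ ^ 2) (B := (D / 2 : ℝ) ^ 2)
    (ε := (3 / (8 * D * ((j : ℝ) + 1))) ^ 2) (j + 1) (3 * D ^ 4 * (j + 1) ^ 2)
    (fun i => hA.1.norm_sq_add_norm_sq_sub_le (hTpos i) (hTlt i) (hV i) (hZ i) (hV _) (hZ _))
    (fun i => sq_nonneg _) (fun i => pow_le_pow_left₀ (norm_nonneg _) (huZ i) 2)
    (by
      push_cast
      have : (3 * (D : ℝ) ^ 4 * ((j : ℝ) + 1) ^ 2) * (3 / (8 * D * ((j : ℝ) + 1))) ^ 2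
        = 27 / 64 * D ^ 2 := by
        field_simp
        norm_num
      rw [this]
      nlinarith [sq_nonneg (D : ℝ)])
    (by positivity)
  set n := j + 1 + i with hn
  have hstep' : ‖Z n - Z (n + 1)‖ ≤ 3 / (8 * D * ((j : ℝ) + 1)) :=
    le_of_sq_le_sq hstep (by positivity)
  have hnR : n ≤ 4 * D ^ 4 * (j + 1) ^ 2 := by
    have h1 : 1 ≤ D ^ 4 := Nat.one_le_pow _ _ hD
    nlinarith [Nat.mul_le_mul h1 (le_refl ((j + 1) ^ 2))]
  set N := 24 * D * (m n + 1) ^ 2 with hN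
  have hNle : N ≤ beta D j g := by
    have := wFun_iterate_monotone hD g hnR
    unfold beta
    rw [hN]
    gcongr
  have hgN : g N ≤ m (n + 1) := by
    simp only [hm, Function.iterate_succ_apply']
    exact le_max_left _ _
  -- Two consecutive resolvents avoid circularity: N depends only on T n, so the variational
  -- inequality is proved at Z n, while the smallness in terms of g N comes from T (n + 1). The
  -- small step transfers the inequality to Z (n + 1).
  refine ⟨N, hNle, Z (n + 1), V (n + 1), hV _, ?_, huZ _, hZp _, ?_⟩
  · have h1 : T (n + 1) * ‖V (n + 1)‖ ≤ D / 2 := by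
      rw [← abs_of_pos (hTpos (n + 1)), ← Real.norm_eq_abs, ← norm_smul]
      have : T (n + 1) • V (n + 1) = u - Z (n + 1) := by
        rw [eq_sub_iff_add_eq, add_comm]; exact (hZ _).symm
      rw [this]
      exact huZ _
    have h2 : (g N : ℝ) ≤ m (n + 1) := by exact_mod_cast hgN
    have h3 : ((m (n + 1) : ℝ) + 1) * ‖V (n + 1)‖ ≤ c := by
      have : T (n + 1) * ‖V (n + 1)‖ = D / (2 * c) * (((m (n + 1) : ℝ) + 1) * ‖V (n + 1)‖) := by
        simp only [hT]; ring
      rw [this] at h1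
      have h4 : (D / 2 : ℝ) = D / (2 * c) * c := by field_simp
      rw [h4] at h1
      exact le_of_mul_le_mul_left h1 (by positivity)
    rw [le_div_iff₀ (by positivity)]
    nlinarith [norm_nonneg (V (n + 1))]
  · intro x x' v σ hv hx hσ hxp hx'p hρ
    have hMj : (D : ℝ) * ((j : ℝ) + 1) ≤ (m n : ℝ) + 1 := by
      have h1 : D * (j + 1) ≤ m n :=
        (Nat.mul_le_mul_left D (by omega)).trans (mul_le_wFun_iterate hD g n)
      have h2 : (D : ℝ) * ((j : ℝ) + 1) ≤ m n := by exact_mod_cast h1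
      linarith
    have hT' : T n * (c * ‖x - x'‖) = D * ((m n : ℝ) + 1) / 2 * ‖x - x'‖ := by
      simp only [hT]
      field_simp
    have hNr : (N : ℝ) = 24 * D * ((m n : ℝ) + 1) ^ 2 := by simp [hN]
    rw [hNr] at hρ
    have b1 := hA.1.inner_le_of_residual hc' (hTpos n) (hV n) (hZ n) (huZ n) (hZp n) hv hx hσ hx'p
    rw [hT'] at b1
    have b2 := approx_projection_bound hD1 (by simp) (norm_nonneg (x - x'))
      (by positivity : (0 : ℝ) < (j : ℝ) + 1) hMj hρ
    have b3 := inner_sub_le_of_norm_sub_le (huZ n) (hZp (n + 1)) hxp hstep'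
    have e2 : 1 / (4 * ((j : ℝ) + 1)) + 2 * D * (3 / (8 * D * ((j : ℝ) + 1)))
        = 1 / ((j : ℝ) + 1) := by
      field_simp
      norm_num
    linarith

end ApproximateProjection

/-! ### The dichotomy for real sequences -/

section RealSequences

/-- The inequalities satisfied by `s n = ‖y n - z‖ ^ 2`, the residuals `ρ n`, the inner products
`q n = ⟪u - z, y n - z⟫` and errors `e n`. -/
structure IsPPARecursion (D : ℝ) (s lam del ρ q e : ℕ → ℝ) : Prop where
  s_nonneg : ∀ i, 0 ≤ s i
  s_le : ∀ i, s i ≤ 4 * D ^ 2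
  ρ_nonneg : ∀ i, 0 ≤ ρ i
  lam_nonneg : ∀ i, 0 ≤ lam i
  lam_le_one : ∀ i, lam i ≤ 1
  residual : ∀ i, del i * ρ i ^ 2 ≤ s i - s (i + 1) + lam i * (D ^ 2 / 4) + 3 * D * e i
  step : ∀ i, s (i + 1) ≤ (1 - lam i) * s i + 2 * lam i * q (i + 1) + 3 * D * e i
  shift : ∀ i, q (i + 1) ≤ q i + D / 2 * (lam i * (3 * D / 2) + ρ i)
  residual_sq : ∀ i, ρ i ^ 2 ≤ s i + 3 * D * e i

/-- Since 1 - λ ≤ exp (-λ), the initial value decays. The η term enters through convex combinations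
and does not accumulate; only ε does. -/
lemma le_exp_mul_add {s lam : ℕ → ℝ} {η ε : ℝ} {m T : ℕ} (hs0 : 0 ≤ s m)
    (hlam0 : ∀ i, 0 ≤ lam i) (hlam1 : ∀ i, lam i ≤ 1) (hη : 0 ≤ η) (hε : 0 ≤ ε)
    (hs : ∀ i < T, s (m + i + 1) ≤ (1 - lam (m + i)) * s (m + i) + lam (m + i) * η + ε) :
    ∀ n ≤ T, s (m + n) ≤ Real.exp (-∑ i ∈ Finset.range n, lam (m + i)) * s m + η + n * ε := by
  intro n hn
  induction n with
  | zero => simpa using hη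
  | succ n ih =>
    have h1 := hs n (by omega)
    have h2 := mul_le_mul_of_nonneg_left (ih (by omega)) (sub_nonneg.2 (hlam1 (m + n)))
    have h3 : 1 - lam (m + n) ≤ Real.exp (-lam (m + n)) := by
      linarith [Real.add_one_le_exp (-lam (m + n))]
    set E := Real.exp (-∑ i ∈ Finset.range n, lam (m + i)) with hE
    have h4 : Real.exp (-∑ i ∈ Finset.range (n + 1), lam (m + i)) =
        Real.exp (-lam (m + n)) * E := by
      rw [Finset.sum_range_succ, hE, ← Real.exp_add]
      ring_nf
    have h5 : (1 - lam (m + n)) * (E * s m) ≤ Real.exp (-lam (m + n)) * (E * s m) :=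
      mul_le_mul_of_nonneg_right h3 (mul_nonneg (Real.exp_pos _).le hs0)
    have h6 : 0 ≤ lam (m + n) * (n * ε) := mul_nonneg (hlam0 _) (by positivity)
    rw [h4, ← add_assoc]
    push_cast
    linarith

/-- The rate of divergence `L` gives a lower bound for the sum of `lam` over a window. -/
lemma le_sum_window {lam : ℕ → ℝ} {L : ℕ → ℕ} (hlam0 : ∀ i, 0 ≤ lam i) (hlam1 : ∀ i, lam i ≤ 1)
    (hL : ∀ k : ℕ, (k : ℝ) ≤ ∑ i ∈ Finset.Icc 1 (L k), lam i) {m M n : ℕ}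
    (hn : L (m + M) + 1 ≤ m + n) : (M : ℝ) ≤ ∑ i ∈ Finset.range n, lam (m + i) := by
  have h1 : ∑ i ∈ Finset.Icc 1 (L (m + M)), lam i ≤ ∑ i ∈ Finset.range (m + n), lam i :=
    Finset.sum_le_sum_of_subset_of_nonneg
      (fun i hi => by simp only [Finset.mem_Icc, Finset.mem_range] at *; omega)
      (fun i _ _ => hlam0 i)
  -- The terms before the window sum to at most m, which is why L is evaluated at m + M.
  have h2 : ∑ i ∈ Finset.range m, lam i ≤ m := by
    simpa using Finset.sum_le_card_nsmul (Finset.range m) lam 1 (fun i _ => hlam1 i)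
  rw [Finset.sum_range_add] at h1
  have h3 := hL (m + M)
  push_cast at h3
  linarith

lemma le_divergenceRate {lam : ℕ → ℝ} {L : ℕ → ℕ} (hlam1 : ∀ i, lam i ≤ 1)
    (hL : ∀ k : ℕ, (k : ℝ) ≤ ∑ i ∈ Finset.Icc 1 (L k), lam i) (k : ℕ) : k ≤ L k := by
  have h2 : ∑ i ∈ Finset.Icc 1 (L k), lam i ≤ L k := by
    simpa using Finset.sum_le_card_nsmul (Finset.Icc 1 (L k)) lam 1 (fun i _ => hlam1 i)
  exact_mod_cast (hL k).trans h2

lemma le_sigmaBar {lam : ℕ → ℝ} {L : ℕ → ℕ} (hlam1 : ∀ i, lam i ≤ 1)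
    (hL : ∀ k : ℕ, (k : ℝ) ≤ ∑ i ∈ Finset.Icc 1 (L k), lam i) (D k m : ℕ) :
    m ≤ sigmaBar L D k m :=
  (Nat.le_add_right _ _).trans ((le_divergenceRate hlam1 hL _).trans (Nat.le_succ _))

lemma exp_neg_ceil_log_mul_le {D k : ℕ} (hD : 0 < D) {s S : ℝ} (hs0 : 0 ≤ s)
    (hs : s ≤ 4 * (D : ℝ) ^ 2)
    (hS : (⌈Real.log (12 * (D : ℝ) ^ 2 * ((k : ℝ) + 1))⌉₊ : ℝ) ≤ S) :
    Real.exp (-S) * s ≤ 1 / (3 * ((k : ℝ) + 1)) := by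
  have hD' : (0 : ℝ) < D := by exact_mod_cast hD
  have hpos : 0 < 12 * (D : ℝ) ^ 2 * ((k : ℝ) + 1) := by positivity
  have h1 : Real.exp (-S) ≤ (12 * (D : ℝ) ^ 2 * ((k : ℝ) + 1))⁻¹ := by
    rw [Real.exp_neg]
    refine inv_anti₀ hpos ?_
    rw [← Real.log_le_iff_le_exp hpos]
    exact (Nat.le_ceil _).trans hS
  calc Real.exp (-S) * s ≤ (12 * (D : ℝ) ^ 2 * ((k : ℝ) + 1))⁻¹ * (4 * (D : ℝ) ^ 2) := by gcongr
    _ = 1 / (3 * ((k : ℝ) + 1)) := by field_simp; norm_num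

/-- Metastability of bounded sequences that decrease up to `phi2 D j n g`. -/
lemma exists_metastable_of_antitone {s : ℕ → ℝ} {D j n : ℕ} {g : ℕ → ℕ} (hD : 0 < D)
    (hg : Monotone g) (hn : n ≤ g n) (hs0 : ∀ i, 0 ≤ s i) (hs : ∀ i, s i ≤ 4 * (D : ℝ) ^ 2) :
    ∃ m, n ≤ m ∧ g m ≤ phi2 D j n g ∧ m ≤ phi2 D j n g ∧ s m - s (g m) ≤ 1 / ((j : ℝ) + 1) := by
  have hmono : Monotone fun i => g^[i] n := hg.monotone_iterate_of_le_map hn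
  by_contra! hlt
  -- If every candidate failed, s would lose more than 1 / (j + 1) along each iterate of g,
  -- exhausting its range [0, 4 D²].
  have key : ∀ i ≤ 4 * D ^ 2 * (j + 1), 0 < i →
      s (g^[i] n) < 4 * (D : ℝ) ^ 2 - i * (1 / ((j : ℝ) + 1)) := by
    intro i hi hi0
    induction i with
    | zero => omega
    | succ i ih =>
      have h1 := hlt (g^[i] n) (hmono (Nat.zero_le i))
        (by rw [← Function.iterate_succ_apply' g]; exact (hmono hi).trans (le_max_right _ _))
        ((hmono (Nat.le_of_succ_le hi)).trans (le_max_right _ _))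
      rw [← Function.iterate_succ_apply' g] at h1
      push_cast
      rcases Nat.eq_zero_or_pos i with rfl | hi'
      · simp only [Nat.cast_zero]
        linarith [hs (g^[0] n)]
      · linarith [ih (by omega) hi']
  have h1 := key _ le_rfl (by positivity)
  have h2 : ((4 * D ^ 2 * (j + 1) : ℕ) : ℝ) * (1 / ((j : ℝ) + 1)) = 4 * (D : ℝ) ^ 2 := by
    push_cast
    field_simp
  linarith [hs0 (g^[4 * D ^ 2 * (j + 1)] n)]

/-- After an increase of `s`, every value is dominated by a value right after an increase. -/
lemma exists_increase_dominating {s : ℕ → ℝ} {n₀ : ℕ} (h : s n₀ < s (n₀ + 1)) {i : ℕ}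
    (hi : n₀ < i) : ∃ t, n₀ ≤ t ∧ t < i ∧ s t < s (t + 1) ∧ s i ≤ s (t + 1) := by
  induction i, hi using Nat.le_induction with
  | base => exact ⟨n₀, le_rfl, Nat.lt_succ_self _, h, le_rfl⟩
  | succ i hi ih =>
    rcases lt_or_ge (s i) (s (i + 1)) with h1 | h1
    · exact ⟨i, by omega, by omega, h1, le_rfl⟩
    · obtain ⟨t, h2, h3, h4, h5⟩ := ih
      exact ⟨t, h2, by omega, h4, h1.trans h5⟩

lemma sq_le_of_residual {c D X del ρ a b lam : ℝ} (hc : 0 < c) (hD : 0 < D) (hX : 0 < X)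
    (hdel : 1 / c ≤ del) (h : del * ρ ^ 2 ≤ a + lam * (D ^ 2 / 4) + b) (ha : a ≤ 1 / (12 * c * X))
    (hlam : lam ≤ 1 / (96 * c * D ^ 2 * X)) (hb : b ≤ 1 / (24 * c * X)) : ρ ^ 2 ≤ 1 / X := by
  have h1 : 1 / c * ρ ^ 2 ≤ del * ρ ^ 2 := mul_le_mul_of_nonneg_right hdel (sq_nonneg _)
  have h2 : lam * (D ^ 2 / 4) ≤ 1 / (96 * c * D ^ 2 * X) * (D ^ 2 / 4) := by gcongr
  have h3 : 1 / (12 * c * X) + 1 / (96 * c * D ^ 2 * X) * (D ^ 2 / 4) + 1 / (24 * c * X)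
      ≤ 1 / c * (1 / X) := by
    have : 1 / c * (1 / X) - (1 / (12 * c * X) + 1 / (96 * c * D ^ 2 * X) * (D ^ 2 / 4)
        + 1 / (24 * c * X)) = (335 / 384) / (c * X) := by
      field_simp
      norm_num
    have h4 : 0 ≤ (335 / 384) / (c * X) := by positivity
    linarith
  exact le_of_mul_le_mul_left (by linarith) (by positivity : 0 < 1 / c)

lemma sq_le_of_residual_increase {c D del ρ r lam b : ℝ} (hc : 0 < c) (hD : 0 < D) (hr : 0 < r)
    (hdel : 1 / c ≤ del) (h : del * ρ ^ 2 ≤ lam * (D ^ 2 / 4) + b)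
    (hlam : lam ≤ 1 / (16 * c * r ^ 2 * D ^ 2)) (hb : b ≤ 1 / (8 * c * r ^ 2)) :
    ρ ^ 2 ≤ (1 / r) ^ 2 := by
  have h1 : 1 / c * ρ ^ 2 ≤ del * ρ ^ 2 := mul_le_mul_of_nonneg_right hdel (sq_nonneg _)
  have h2 : lam * (D ^ 2 / 4) ≤ 1 / (16 * c * r ^ 2 * D ^ 2) * (D ^ 2 / 4) := by gcongr
  have h3 : 1 / (16 * c * r ^ 2 * D ^ 2) * (D ^ 2 / 4) + 1 / (8 * c * r ^ 2)
      ≤ 1 / c * (1 / r) ^ 2 := by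
    have : 1 / c * (1 / r) ^ 2 - (1 / (16 * c * r ^ 2 * D ^ 2) * (D ^ 2 / 4) + 1 / (8 * c * r ^ 2))
        = (55 / 64) / (c * r ^ 2) := by
      field_simp
      norm_num
    have h4 : 0 ≤ (55 / 64) / (c * r ^ 2) := by positivity
    linarith
  exact le_of_mul_le_mul_left (by linarith) (by positivity : 0 < 1 / c)

lemma le_of_antitone_window {s : ℕ → ℝ} {m G : ℕ} (h : ∀ i, m ≤ i → i < G → s (i + 1) ≤ s i)
    {a b : ℕ} (ha : m ≤ a) (hab : a ≤ b) (hb : b ≤ G) : s b ≤ s a := by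
  induction b, hab using Nat.le_induction with
  | base => exact le_rfl
  | succ b hab ih => exact (h b (ha.trans hab) hb).trans (ih (Nat.le_of_succ_le hb))

/-- If `s` is almost constant and decreasing on a window, it is small at the end of it. -/
lemma IsPPARecursion.le_of_antitone {D : ℕ} {s lam del ρ q e : ℕ → ℝ}
    (hR : IsPPARecursion D s lam del ρ q e) {L : ℕ → ℕ} {c N k m F G : ℕ} (hc : 0 < c) (hD : 0 < D)
    (hL : ∀ k : ℕ, (k : ℝ) ≤ ∑ i ∈ Finset.Icc 1 (L k), lam i)
    (hdel : ∀ i, 1 / (c : ℝ) ≤ del i)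
    (hq : ∀ i, ρ i ≤ 1 / ((N : ℝ) + 1) → q i ≤ 1 / (32 * ((k : ℝ) + 1) ^ 2))
    (hs : ∀ i, m ≤ i → i < G → s (i + 1) ≤ s i)
    (hsm : s m - s G ≤ 1 / (12 * c * ((N : ℝ) + 1) ^ 2))
    (hlam : ∀ i, m ≤ i → lam i ≤ 1 / (96 * c * (D : ℝ) ^ 2 * ((N : ℝ) + 1) ^ 2))
    (hE1 : ∀ i < G, 3 * D * e i ≤ 1 / (24 * c * ((N : ℝ) + 1) ^ 2))
    (hE2 : ∀ i < G, 3 * D * e i ≤ 1 / (12 * ((k : ℝ) + 1) * ((F : ℝ) + 1)))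
    (hGF : G ≤ F + 2) {i : ℕ} (hi : sigmaBar L D k m ≤ i) (hiG : i + 2 ≤ G) :
    s i ≤ 1 / ((k : ℝ) + 1) := by
  have hc' : (0 : ℝ) < c := by exact_mod_cast hc
  have hD' : (0 : ℝ) < D := by exact_mod_cast hD
  -- On a decreasing window each single decrement is at most s m - s G.
  have hρ : ∀ i, m ≤ i → i < G → ρ i ≤ 1 / ((N : ℝ) + 1) := by
    intro i hmi hiG
    have h1 : s i ≤ s m := le_of_antitone_window hs le_rfl hmi hiG.le
    have h2 : s G ≤ s (i + 1) := le_of_antitone_window hs (by omega) hiG le_rfl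
    have h3 := sq_le_of_residual hc' hD' (by positivity : (0 : ℝ) < ((N : ℝ) + 1) ^ 2) (hdel i)
      (hR.residual i) (by linarith) (hlam i hmi) (hE1 i hiG)
    rw [← one_div_pow] at h3
    exact le_of_sq_le_sq h3 (by positivity)
  have hmi : m ≤ i := (le_sigmaBar hR.lam_le_one hL D k m).trans hi
  obtain ⟨n, rfl⟩ := Nat.exists_eq_add_of_le hmi
  have h1 := le_exp_mul_add (η := 1 / (16 * ((k : ℝ) + 1) ^ 2))
    (ε := 1 / (12 * ((k : ℝ) + 1) * ((F : ℝ) + 1))) (T := n) (hR.s_nonneg m) hR.lam_nonneg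
    hR.lam_le_one (by positivity) (by positivity)
    (by
      intro j hj
      have a1 := hR.step (m + j)
      have a2 := hq (m + j + 1) (hρ _ (by omega) (by omega))
      have a3 := hE2 (m + j) (by omega)
      have a4 := mul_le_mul_of_nonneg_left a2 (hR.lam_nonneg (m + j))
      have a5 : 1 / (16 * ((k : ℝ) + 1) ^ 2) = 2 * (1 / (32 * ((k : ℝ) + 1) ^ 2)) := by
        field_simp
        norm_num
      rw [a5]
      linarith) n le_rfl
  have h2 := exp_neg_ceil_log_mul_le hD (k := k) (hR.s_nonneg m) (hR.s_le m)
    (le_sum_window hR.lam_nonneg hR.lam_le_one hL hi)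
  have hnF : (n : ℝ) ≤ (F : ℝ) + 1 := by
    have : n ≤ F + 1 := by omega
    exact_mod_cast this
  have h3 : (n : ℝ) * (1 / (12 * ((k : ℝ) + 1) * ((F : ℝ) + 1))) ≤ 1 / (12 * ((k : ℝ) + 1)) := by
    calc _ ≤ ((F : ℝ) + 1) * (1 / (12 * ((k : ℝ) + 1) * ((F : ℝ) + 1))) := by gcongr
      _ = _ := by field_simp
  have h4 : 1 / (16 * ((k : ℝ) + 1) ^ 2) ≤ 1 / (16 * ((k : ℝ) + 1)) := by
    gcongr
    nlinarith [Nat.cast_nonneg (α := ℝ) k]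
  have h5 : 1 / (3 * ((k : ℝ) + 1)) + 1 / (16 * ((k : ℝ) + 1)) + 1 / (12 * ((k : ℝ) + 1))
      = (23 / 48) * (1 / ((k : ℝ) + 1)) := by
    field_simp
    norm_num
  have h6 : 0 ≤ 1 / ((k : ℝ) + 1) := by positivity
  linarith

/-- If `s` increases at `t`, then `s (t + 1)` is small. -/
lemma IsPPARecursion.le_of_increase {D c N k H r t : ℕ} {s lam del ρ q e : ℕ → ℝ}
    (hR : IsPPARecursion D s lam del ρ q e) (hc : 0 < c) (hD : 0 < D) (hH : 0 < H)
    (hdel : 1 / (c : ℝ) ≤ del t)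
    (hq : ρ t ≤ 1 / ((N : ℝ) + 1) → q t ≤ 1 / (32 * ((k : ℝ) + 1) ^ 2))
    (ht : s t < s (t + 1)) (hr1 : 2 * (N + 1) ≤ r) (hr2 : 128 * D * (k + 1) ^ 2 ≤ r)
    (hlamH : 1 / (H : ℝ) ≤ lam t)
    (hlam1 : lam t ≤ 1 / (256 * (D : ℝ) ^ 2 * ((k : ℝ) + 1) ^ 2))
    (hlam2 : lam t ≤ 1 / (16 * c * (r : ℝ) ^ 2 * (D : ℝ) ^ 2))
    (hE1 : 3 * D * e t ≤ 1 / (32 * (H : ℝ) * ((k : ℝ) + 1) ^ 2))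
    (hE2 : 3 * D * e t ≤ 1 / (8 * c * (r : ℝ) ^ 2)) : s (t + 1) ≤ 1 / ((k : ℝ) + 1) := by
  have hc' : (0 : ℝ) < c := by exact_mod_cast hc
  have hD' : (0 : ℝ) < D := by exact_mod_cast hD
  have hH' : (0 : ℝ) < H := by exact_mod_cast hH
  have hr1' : (N : ℝ) + 1 ≤ r := by
    have : N + 1 ≤ r := by omega
    exact_mod_cast this
  have hr2' : 128 * (D : ℝ) * ((k : ℝ) + 1) ^ 2 ≤ r := by exact_mod_cast hr2
  have hr0 : (0 : ℝ) < r := lt_of_lt_of_le (by positivity) hr1'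
  have hρ : ρ t ≤ 1 / r := le_of_sq_le_sq (sq_le_of_residual_increase hc' hD' hr0 hdel
    (by linarith [hR.residual t]) hlam2 hE2) (by positivity)
  have hqt := hq (hρ.trans (by gcongr))
  have hρ2 : ρ t ≤ 1 / (128 * (D : ℝ) * ((k : ℝ) + 1) ^ 2) := hρ.trans (by gcongr)
  have hlam0 : 0 < lam t := lt_of_lt_of_le (by positivity) hlamH
  have hX : (0 : ℝ) < 1 / ((k : ℝ) + 1) ^ 2 := by positivity
  set X : ℝ := 1 / ((k : ℝ) + 1) ^ 2 with hXdef
  -- The bound `hq` applies at t, but the recursion needs t + 1; the shift costs 7/1024 on top of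
  -- 1/32.
  have hq1 : q (t + 1) ≤ 39 / 1024 * X := by
    have h1 : D / 2 * (lam t * (3 * D / 2) + ρ t) ≤
        D / 2 * (1 / (256 * (D : ℝ) ^ 2 * ((k : ℝ) + 1) ^ 2) * (3 * D / 2)
          + 1 / (128 * (D : ℝ) * ((k : ℝ) + 1) ^ 2)) := by gcongr
    have h2 : D / 2 * (1 / (256 * (D : ℝ) ^ 2 * ((k : ℝ) + 1) ^ 2) * (3 * D / 2)
          + 1 / (128 * (D : ℝ) * ((k : ℝ) + 1) ^ 2)) = 7 / 1024 * X := by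
      rw [hXdef]
      field_simp
      norm_num
    have h3 : 1 / (32 * ((k : ℝ) + 1) ^ 2) = 1 / 32 * X := by
      rw [hXdef]
      field_simp
    linarith [hR.shift t]
  have hE : 3 * D * e t ≤ lam t * (1 / 32 * X) := by
    refine hE1.trans ?_
    have : 1 / (32 * (H : ℝ) * ((k : ℝ) + 1) ^ 2) = 1 / (H : ℝ) * (1 / 32 * X) := by
      rw [hXdef]
      field_simp
    rw [this]
    gcongr
  -- Replacing s t by the larger s (t + 1) in the recursion leaves λ t * s (t + 1) on the left, and
  -- λ t cancels.
  have h1 := mul_le_mul_of_nonneg_left ht.le (sub_nonneg.2 (hR.lam_le_one t))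
  have h2 := mul_le_mul_of_nonneg_left hq1 hlam0.le
  have h3 : lam t * s (t + 1) ≤ lam t * X := by
    nlinarith [hR.step t, mul_pos hlam0 hX]
  refine (le_of_mul_le_mul_left h3 hlam0).trans ?_
  rw [hXdef]
  gcongr
  nlinarith [Nat.cast_nonneg (α := ℝ) k]

/-- Accounts for the factor 6 D + 1 in `Xi1` and `xi`. -/
lemma three_mul_le_of_le {D : ℕ} {e Y : ℝ} (hY : 0 < Y)
    (h : e ≤ 1 / ((6 * D + 1) * Y)) : 3 * D * e ≤ 1 / (2 * Y) := by
  have h1 : 3 * D * e ≤ 3 * D * (1 / ((6 * D + 1) * Y)) := by gcongr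
  refine h1.trans ?_
  rw [mul_one_div, div_le_div_iff₀ (by positivity) (by positivity)]
  nlinarith

lemma le_one_div_of_r3_le {lam : ℕ → ℝ} {ℓ : ℕ → ℕ} {k c D N i : ℕ}
    (hQ2 : ∀ k n : ℕ, ℓ k ≤ n → lam n ≤ 1 / ((k : ℝ) + 1)) (hi : r3 k c ℓ D N ≤ i)
    {K : ℝ} (hK : 0 < K)
    (hKle : K ≤ (max (max (96 * c * D ^ 2 * (N + 1) ^ 2 - 1) (256 * D ^ 2 * (k + 1) ^ 2 - 1))
      (16 * c * (r2 k D N) ^ 2 * D ^ 2) : ℕ) + 1) : lam i ≤ 1 / K :=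
  (hQ2 _ i hi).trans (one_div_le_one_div_of_le hK hKle)

lemma fTilde2_monotone {k D : ℕ} {f L : ℕ → ℕ} (hf : Monotone f) (hL : Monotone L) :
    Monotone (fTilde2 k f L D) := by
  intro a b hab
  unfold fTilde2 fTilde sigmaBar
  gcongr
  exact hf (Nat.succ_le_succ (hL (by omega)))

lemma phi2_le_apply {g : ℕ → ℕ} (hg : Monotone g) {n : ℕ} (hn : n ≤ g n) (D j : ℕ) :
    phi2 D j n g ≤ phi1 D j n g := by
  have hmono : Monotone fun i => g^[i] n := hg.monotone_iterate_of_le_map hn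
  have h1 : phi2 D j n g = g^[4 * D ^ 2 * (j + 1)] n :=
    max_eq_right (hmono (Nat.zero_le (4 * D ^ 2 * (j + 1))))
  rw [phi1, h1, ← Function.iterate_succ_apply' g]
  exact hmono (Nat.le_succ _)

/-- Metastability for the sequence `s`, uniformly in the approximation level `N`. -/
theorem IsPPARecursion.exists_window {D c N k : ℕ} {s lam del ρ q e : ℕ → ℝ}
    (hR : IsPPARecursion D s lam del ρ q e) (hc : 0 < c) (hD : 0 < D) {h ℓ L C f : ℕ → ℕ}
    (hmono : Monotone h) (hLmono : Monotone L) (hf : Monotone f)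
    (hpos : ∀ n, 0 < h n)
    (hQ1 : ∀ n, 1 / (h n : ℝ) ≤ lam n)
    (hQ2 : ∀ k n : ℕ, ℓ k ≤ n → lam n ≤ 1 / ((k : ℝ) + 1))
    (hL : ∀ k : ℕ, (k : ℝ) ≤ ∑ i ∈ Finset.Icc 1 (L k), lam i)
    (hdel : ∀ i, 1 / (c : ℝ) ≤ del i)
    (hq : ∀ i, ρ i ≤ 1 / ((N : ℝ) + 1) → q i ≤ 1 / (32 * ((k : ℝ) + 1) ^ 2))
    (he : ∀ j n i, i ≤ n → zeta c C j n ≤ Xi k f c C ℓ L D h N → e i ≤ 1 / ((j : ℝ) + 1)) :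
    ∃ n ≤ max (sigmaBar L D k (phi2 D (r1 c N) (r3 k c ℓ D N) (fTilde2 k f L D)))
      (Phi k c f ℓ L D N), ∀ i ∈ Set.Icc n (f n), ρ i ^ 2 ≤ 2 / ((k : ℝ) + 1) := by
  have hc' : (0 : ℝ) < c := by exact_mod_cast hc
  have hD' : (0 : ℝ) < D := by exact_mod_cast hD
  have hσmono : Monotone (sigmaBar L D k) := by
    intro a b hab
    exact Nat.succ_le_succ (hLmono (by omega))
  have hσ := le_sigmaBar hR.lam_le_one hL D k
  set g := fTilde2 k f L D with hg
  have hgmono : Monotone g := fTilde2_monotone hf hLmono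
  set n₁ := r3 k c ℓ D N with hn₁
  set φ := phi2 D (r1 c N) n₁ g with hφ
  set P := Phi k c f ℓ L D N with hP
  set r := r2 k D N with hr
  have hlam1 : ∀ i, n₁ ≤ i → lam i ≤ 1 / (96 * c * (D : ℝ) ^ 2 * ((N : ℝ) + 1) ^ 2) := by
    refine fun i hi => le_one_div_of_r3_le hQ2 hi (by positivity) ?_
    exact_mod_cast Nat.sub_le_iff_le_add.1 ((le_max_left _ _).trans (le_max_left _ _))
  have hlam2 : ∀ i, n₁ ≤ i → lam i ≤ 1 / (256 * (D : ℝ) ^ 2 * ((k : ℝ) + 1) ^ 2) := by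
    refine fun i hi => le_one_div_of_r3_le hQ2 hi (by positivity) ?_
    exact_mod_cast Nat.sub_le_iff_le_add.1 ((le_max_right _ _).trans (le_max_left _ _))
  have hr0 : 0 < r := lt_of_lt_of_le (by positivity) (le_max_left _ _)
  have hr0' : (0 : ℝ) < r := by exact_mod_cast hr0
  have hlam3 : ∀ i, n₁ ≤ i → lam i ≤ 1 / (16 * c * (r : ℝ) ^ 2 * (D : ℝ) ^ 2) := by
    refine fun i hi => le_one_div_of_r3_le hQ2 hi (by positivity) ?_
    exact_mod_cast (le_max_right _ _).trans (Nat.le_succ _)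
  have hr1 : 12 * c * (N + 1) ^ 2 = r1 c N + 1 :=
    (Nat.sub_add_cancel (Nat.succ_le_of_lt (by positivity))).symm
  have hr1' : 12 * (c : ℝ) * ((N : ℝ) + 1) ^ 2 = (r1 c N : ℝ) + 1 := by exact_mod_cast hr1
  have hr1low : 6 * (c : ℝ) * ((N : ℝ) + 1) ^ 2 ≤ r1 c N := by
    have : 1 ≤ c * (N + 1) ^ 2 := Nat.succ_le_of_lt (by positivity)
    have h2 : (1 : ℝ) ≤ c * ((N : ℝ) + 1) ^ 2 := by exact_mod_cast this
    linarith
  have hEdec : ∀ i ≤ P, 3 * D * e i ≤ 1 / (4 * ((max (r1 c N) (r4 k c f ℓ D L N) : ℕ) : ℝ)) := by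
    intro i hi
    set Q := max (r1 c N) (r4 k c f ℓ D L N) with hQ
    have hQ0 : 0 < Q := lt_of_lt_of_le (by unfold r4; positivity) (le_max_right _ _)
    have hQ0' : (0 : ℝ) < Q := by exact_mod_cast hQ0
    have h1 := he (2 * (6 * D + 1) * Q - 1) P i hi (le_max_left _ _)
    have h2 : ((2 * (6 * D + 1) * Q - 1 : ℕ) : ℝ) + 1 = (6 * D + 1) * (2 * Q) := by
      have : 2 * (6 * D + 1) * Q - 1 + 1 = (6 * D + 1) * (2 * Q) := by
        rw [Nat.sub_add_cancel (Nat.succ_le_of_lt (by positivity))]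
        ring
      exact_mod_cast this
    rw [h2] at h1
    have h3 := three_mul_le_of_le (by positivity) h1
    rwa [← mul_assoc, show (2 : ℝ) * 2 = 4 by norm_num] at h3
  have hE1 : ∀ i ≤ P, 3 * D * e i ≤ 1 / (24 * c * ((N : ℝ) + 1) ^ 2) := by
    refine fun i hi => (hEdec i hi).trans (one_div_le_one_div_of_le (by positivity) ?_)
    have : (r1 c N : ℝ) ≤ (max (r1 c N) (r4 k c f ℓ D L N) : ℕ) := by
      exact_mod_cast le_max_left _ _
    linarith
  have hE2 : ∀ i ≤ P,
      3 * D * e i ≤ 1 / (12 * ((k : ℝ) + 1) * ((fTilde k f L D φ : ℝ) + 1)) := by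
    refine fun i hi => (hEdec i hi).trans (one_div_le_one_div_of_le (by positivity) ?_)
    have h1 : 3 * (k + 1) * (fTilde k f L D φ + 1) ≤ max (r1 c N) (r4 k c f ℓ D L N) :=
      le_max_right _ _
    have : 3 * ((k : ℝ) + 1) * ((fTilde k f L D φ : ℝ) + 1) ≤
        (max (r1 c N) (r4 k c f ℓ D L N) : ℕ) := by
      exact_mod_cast h1
    linarith
  have hkk : 1 / ((k : ℝ) + 1) + 1 / ((k : ℝ) + 1) = 2 / ((k : ℝ) + 1) := by ring
  have hEinc : ∀ i ≤ f P, 3 * D * e i ≤ 1 / (32 * (h (f P) : ℝ) * ((k : ℝ) + 1) ^ 2) := by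
    intro i hi
    have hH : (0 : ℝ) < h (f P) := by exact_mod_cast hpos (f P)
    set W := max (16 * h (f P) * (k + 1) ^ 2 * (6 * D + 1))
      (4 * c * (r2 k D P) ^ 2 * (6 * D + 1)) with hW
    have h1 : e i ≤ 1 / ((W : ℝ) + 1) := he W (f P) i hi
      (le_max_right (Xi1 k f c C ℓ L D N) (Xi2 k f c C ℓ L D h N))
    have h2 : (6 * (D : ℝ) + 1) * (16 * h (f P) * ((k : ℝ) + 1) ^ 2) ≤ (W : ℝ) + 1 := by
      have h3 : 16 * h (f P) * (k + 1) ^ 2 * (6 * D + 1) ≤ W := le_max_left _ _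
      have h4 : 16 * (h (f P) : ℝ) * ((k : ℝ) + 1) ^ 2 * (6 * D + 1) ≤ W := by
        exact_mod_cast h3
      linarith
    refine (three_mul_le_of_le (by positivity)
      (h1.trans (one_div_le_one_div_of_le (by positivity) h2))).trans (le_of_eq ?_)
    ring_nf
  -- Both bounds on λ i are compared. As `xi` is evaluated at P while r is taken at N, this is how
  -- the error bound in h (f P) yields the one in r.
  have hhr : ∀ i, n₁ ≤ i → i ≤ f P → 16 * c * (r : ℝ) ^ 2 * (D : ℝ) ^ 2 ≤ h (f P) := by
    intro i hi hi'
    have hH : (0 : ℝ) < h i := by exact_mod_cast hpos i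
    have h1 := (one_div_le_one_div hH (by positivity)).1 ((hQ1 i).trans (hlam3 i hi))
    exact h1.trans (by exact_mod_cast hmono hi')
  -- If g n₁ < n₁, then f (σ̄ n₁) < n₁ ≤ σ̄ n₁ and the window starting at σ̄ n₁ is empty.
  rcases lt_or_ge (g n₁) n₁ with hlt | hge
  · refine ⟨sigmaBar L D k n₁, le_max_of_le_left (hσmono (le_max_left _ _)), fun i hi => ?_⟩
    have h1 : f (sigmaBar L D k n₁) + 2 = g n₁ := rfl
    have h2 := hσ n₁
    have h3 := hi.1.trans hi.2
    omega
  have hφP : φ ≤ P := phi2_le_apply hgmono hge D (r1 c N)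
  -- If s decreases up to φ, metastability gives an almost constant stretch starting at m, and the
  -- window begins at σ̄ m. Otherwise an increase before φ ≤ P dominates the whole window starting
  -- at P.
  by_cases hanti : ∀ i, n₁ ≤ i → i < φ → s (i + 1) ≤ s i
  · obtain ⟨m, hm1, hm2, hm3, hm4⟩ := exists_metastable_of_antitone (j := r1 c N) hD hgmono hge
      hR.s_nonneg hR.s_le
    rw [← hr1'] at hm4
    refine ⟨sigmaBar L D k m, le_max_of_le_left (hσmono hm3), fun i hi => ?_⟩
    have hG : f (sigmaBar L D k m) + 2 = g m := rfl
    have hGF : g m ≤ fTilde k f L D φ + 2 := hgmono hm3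
    have hiG : i + 2 ≤ g m := by
      have := hi.2
      omega
    have h1 := hR.le_of_antitone hc hD hL hdel hq
      (fun i hi hi' => hanti i (hm1.trans hi) (hi'.trans_le hm2)) hm4
      (fun i hi => hlam1 i (hm1.trans hi)) (fun i hi => hE1 i ((hi.le.trans hm2).trans hφP))
      (fun i hi => hE2 i ((hi.le.trans hm2).trans hφP)) hGF hi.1 hiG
    have h2 := hE2 i (le_trans (by omega) (hm2.trans hφP))
    have h3 : 1 / (12 * ((k : ℝ) + 1) * ((fTilde k f L D φ : ℝ) + 1)) ≤ 1 / ((k : ℝ) + 1) := by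
      refine one_div_le_one_div_of_le (by positivity) ?_
      nlinarith [Nat.cast_nonneg (α := ℝ) k, Nat.cast_nonneg (α := ℝ) (fTilde k f L D φ),
        mul_nonneg (Nat.cast_nonneg (α := ℝ) k) (Nat.cast_nonneg (α := ℝ) (fTilde k f L D φ))]
    linarith [hR.residual_sq i]
  · push Not at hanti
    obtain ⟨n₀, hn0, hn0φ, hinc⟩ := hanti
    refine ⟨P, le_max_right _ _, fun i hi => ?_⟩
    obtain ⟨t, ht1, ht2, ht3, ht4⟩ := exists_increase_dominating hinc
      (hn0φ.trans_le (hφP.trans hi.1))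
    have htP : t ≤ f P := ht2.le.trans hi.2
    have hH : (0 : ℝ) < h t := by exact_mod_cast hpos t
    have hEr : 3 * D * e t ≤ 1 / (8 * c * (r : ℝ) ^ 2) := by
      refine (hEinc t htP).trans (one_div_le_one_div_of_le (by positivity) ?_)
      have hD1 : (1 : ℝ) ≤ D := by exact_mod_cast hD
      have hk1 : (1 : ℝ) ≤ ((k : ℝ) + 1) ^ 2 := one_le_pow₀ (by simp)
      have h3 := hhr t (hn0.trans ht1) htP
      have h4 : 16 * c * (r : ℝ) ^ 2 ≤ 16 * c * (r : ℝ) ^ 2 * (D : ℝ) ^ 2 :=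
        le_mul_of_one_le_right (by positivity) (one_le_pow₀ hD1)
      have h5 : (h (f P) : ℝ) ≤ h (f P) * ((k : ℝ) + 1) ^ 2 :=
        le_mul_of_one_le_right (Nat.cast_nonneg _) hk1
      linarith [show 0 ≤ c * (r : ℝ) ^ 2 by positivity]
    have h1 := hR.le_of_increase (r := r) (H := h (f P)) hc hD (hpos _) (hdel t) (hq t) ht3
      (le_max_left _ _) (le_max_right _ _)
      ((one_div_le_one_div_of_le hH (by exact_mod_cast hmono htP)).trans (hQ1 t))
      (hlam2 t (hn0.trans ht1)) (hlam3 t (hn0.trans ht1)) (hEinc t htP) hEr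
    have h2 := hEinc i hi.2
    have h3 : 1 / (32 * (h (f P) : ℝ) * ((k : ℝ) + 1) ^ 2) ≤ 1 / ((k : ℝ) + 1) := by
      refine one_div_le_one_div_of_le (by positivity) ?_
      have h4 : (1 : ℝ) ≤ h (f P) := by exact_mod_cast hpos (f P)
      nlinarith [Nat.cast_nonneg (α := ℝ) k, mul_le_mul_of_nonneg_right h4
        (sq_nonneg ((k : ℝ) + 1))]
    linarith [hR.residual_sq i]

end RealSequences

/-! ### Monotonicity of the moduli in N -/

section Moduli

/-- The iterates of a monotone g at n' increase or decrease according to whether n' ≤ g n'; in the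
decreasing case the entry n' of the maximum takes over. -/
lemma phi2_mono {g : ℕ → ℕ} (hg : Monotone g) (D : ℕ) {j j' n n' : ℕ} (hj : j ≤ j')
    (hn : n ≤ n') : phi2 D j n g ≤ phi2 D j' n' g := by
  refine max_le (hn.trans (le_max_left _ _)) ((hg.iterate _ hn).trans ?_)
  have hjj : 4 * D ^ 2 * (j + 1) ≤ 4 * D ^ 2 * (j' + 1) := by gcongr
  rcases le_total n' (g n') with h | h
  · exact (hg.monotone_iterate_of_le_map h hjj).trans (le_max_right _ _)
  · exact (hg.antitone_iterate_of_map_le h (Nat.zero_le (4 * D ^ 2 * (j + 1)))).trans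
      (le_max_left _ _)

lemma r1_monotone (c : ℕ) : Monotone (r1 c) := by
  intro a b hab
  unfold r1
  gcongr

lemma r3_monotone (k c D : ℕ) {ℓ : ℕ → ℕ} (hℓ : Monotone ℓ) : Monotone (r3 k c ℓ D) := by
  intro a b hab
  refine hℓ ?_
  unfold r2
  gcongr

lemma max_le_mu {c D k N : ℕ} {C ℓ L h f : ℕ → ℕ} (hℓ : Monotone ℓ) (hL : Monotone L)
    (hf : Monotone f) (hN : N ≤ beta D (32 * (k + 1) ^ 2 - 1) (Xi k f c C ℓ L D h)) :
    max (sigmaBar L D k (phi2 D (r1 c N) (r3 k c ℓ D N) (fTilde2 k f L D)))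
      (Phi k c f ℓ L D N) ≤ mu c C ℓ L D h k f := by
  have hg := fTilde2_monotone (k := k) (D := D) hf hL
  have h1 := phi2_mono hg D (r1_monotone c hN) (r3_monotone k c D hℓ hN)
  exact max_le_max (Nat.succ_le_succ (hL (Nat.add_le_add_right h1 _))) (hg h1)

end Moduli

/-! ### The iteration satisfies the recursive inequalities -/

section Iteration

variable {H : Type*} [NormedAddCommGroup H] [InnerProductSpace ℝ H]

/-- Approximate firm nonexpansivity of resolvents at an approximate zero `z`. -/
lemma IsMonotoneOp.resolvent_norm_sq_le {A : H → Set H} (hA : IsMonotoneOp A)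
    {x x' v z a : H} {σ : ℝ} (hσ : 0 < σ) (hv : v ∈ A x') (hx : x = x' + σ • v) (ha : a ∈ A z) :
    ‖x' - z‖ ^ 2 + ‖x' - x‖ ^ 2 ≤ ‖x - z‖ ^ 2 + 2 * (σ * ‖a‖) * ‖x' - z‖ := by
  have h1 := hA _ _ _ _ hv ha
  rw [inner_sub_right] at h1
  have h2 : -(‖x' - z‖ * ‖a‖) ≤ inner ℝ (x' - z) a :=
    (abs_le.1 (abs_real_inner_le_norm _ _)).1
  have h3 : x - z = (x' - z) + σ • v := by rw [hx]; abel
  have h4 : ‖x' - x‖ ^ 2 = ‖σ • v‖ ^ 2 := by rw [hx, sub_add_cancel_left, norm_neg]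
  rw [h3, norm_add_sq_real, h4, real_inner_smul_right]
  nlinarith [mul_nonneg hσ.le (show 0 ≤ inner ℝ (x' - z) v + ‖x' - z‖ * ‖a‖ by linarith)]

/-- The residual of the resolvent is nondecreasing in the parameter. -/
lemma IsMonotoneOp.residual_mono {A : H → Set H} (hA : IsMonotoneOp A) {x a b v w : H} {σ τ : ℝ}
    (hσ : 0 < σ) (hστ : σ ≤ τ) (hv : v ∈ A a) (ha : x = a + σ • v) (hw : w ∈ A b)
    (hb : x = b + τ • w) : ‖a - x‖ ≤ ‖b - x‖ := by
  have hτ : 0 < τ := hσ.trans_le hστ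
  have h1 := hA _ _ _ _ hv hw
  have h2 : a - b = τ • w - σ • v := by
    have : a + σ • v = b + τ • w := ha.symm.trans hb
    rw [sub_eq_sub_iff_add_eq_add, this, add_comm]
  rw [h2] at h1
  simp only [inner_sub_left, inner_sub_right, real_inner_smul_left,
    real_inner_self_eq_norm_sq] at h1
  rw [real_inner_comm v w] at h1
  have h3 := real_inner_le_norm v w
  have h4 : ‖a - x‖ = σ * ‖v‖ := by
    rw [ha, sub_add_cancel_left, norm_neg, norm_smul, Real.norm_eq_abs, abs_of_pos hσ]
  have h5 : ‖b - x‖ = τ * ‖w‖ := by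
    rw [hb, sub_add_cancel_left, norm_neg, norm_smul, Real.norm_eq_abs, abs_of_pos hτ]
  rw [h4, h5]
  -- Then ‖w‖ < ‖v‖ as well, and (σ‖v‖ - τ‖w‖)(‖v‖ - ‖w‖) > 0 contradicts σ‖v‖² + τ‖w‖² ≤ (σ + τ)⟪v,
  -- w⟫.
  by_contra! hlt
  have h6 : ‖w‖ < ‖v‖ := by
    have : σ * ‖w‖ ≤ τ * ‖w‖ := by gcongr
    exact lt_of_mul_lt_mul_left (this.trans_lt hlt) hσ.le
  nlinarith [mul_pos (sub_pos.2 h6) (sub_pos.2 hlt),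
    mul_le_mul_of_nonneg_left h3 (add_pos hσ hτ).le]

lemma norm_sq_convex_comb_le {a b d : H} {α β γ : ℝ} (hα : 0 ≤ α) (hβ : 0 ≤ β) (hγ : 0 ≤ γ)
    (h : α + β + γ = 1) :
    ‖α • a + β • b + γ • d‖ ^ 2 ≤ α * ‖a‖ ^ 2 + β * ‖b‖ ^ 2 + γ * ‖d‖ ^ 2 := by
  have hα' : α = 1 - β - γ := by linarith
  have h1 : α * ‖a‖ ^ 2 + β * ‖b‖ ^ 2 + γ * ‖d‖ ^ 2 - ‖α • a + β • b + γ • d‖ ^ 2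
      = α * β * ‖a - b‖ ^ 2 + α * γ * ‖a - d‖ ^ 2 + β * γ * ‖b - d‖ ^ 2 := by
    simp only [norm_add_sq_real, norm_sub_sq_real, norm_smul, mul_pow, Real.norm_eq_abs, sq_abs,
      inner_add_left, real_inner_smul_left, real_inner_smul_right]
    rw [hα']
    ring
  have h2 : 0 ≤ α * β * ‖a - b‖ ^ 2 + α * γ * ‖a - d‖ ^ 2 + β * γ * ‖b - d‖ ^ 2 := by positivity
  linarith

lemma norm_sq_smul_add_smul_le {b d : H} {β γ : ℝ} (hβ : 0 ≤ β) (hγ : 0 ≤ γ) :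
    ‖β • b + γ • d‖ ^ 2 ≤ (β + γ) * (β * ‖b‖ ^ 2 + γ * ‖d‖ ^ 2) := by
  have h1 : (β + γ) * (β * ‖b‖ ^ 2 + γ * ‖d‖ ^ 2) - ‖β • b + γ • d‖ ^ 2
      = β * γ * ‖b - d‖ ^ 2 := by
    simp only [norm_add_sq_real, norm_sub_sq_real, norm_smul, mul_pow, Real.norm_eq_abs, sq_abs,
      real_inner_smul_left, real_inner_smul_right]
    ring
  have h2 : 0 ≤ β * γ * ‖b - d‖ ^ 2 := by positivity
  linarith

lemma norm_add_sq_le_norm_sq_add (a b : H) : ‖a + b‖ ^ 2 ≤ ‖b‖ ^ 2 + 2 * inner ℝ a (a + b) := by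
  rw [norm_add_sq_real, inner_add_right, real_inner_self_eq_norm_sq]
  nlinarith [sq_nonneg ‖a‖]

lemma IsMonotoneOp.resolvent_norm_sub_zero_le {A : H → Set H} (hA : IsMonotoneOp A)
    {x x' v p : H} {σ : ℝ} (hσ : 0 < σ) (hv : v ∈ A x') (hx : x = x' + σ • v)
    (hp : p ∈ zeroSet A) : ‖x' - p‖ ≤ ‖x - p‖ := by
  have := hA.norm_sq_add_le hp hσ hv hx
  exact le_of_sq_le_sq (by nlinarith [sq_nonneg ‖x - x'‖]) (norm_nonneg _)

variable {A : H → Set H} {u p : H} {cseq lam gam del : ℕ → ℝ} {y J v : ℕ → H} {D : ℝ}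

lemma IsMonotoneOp.iterate_norm_sub_le (hA : IsMonotoneOp A)
    (hcseq : ∀ n, 0 < cseq n) (hlam : ∀ n, lam n ∈ Set.Ioo (0 : ℝ) 1)
    (hdel : ∀ n, del n ∈ Set.Ioo (0 : ℝ) 1) (hgam : ∀ n, gam n ∈ Set.Ico (0 : ℝ) 1)
    (hsum : ∀ n, lam n + gam n + del n = 1) (hv : ∀ n, v n ∈ A (J n))
    (hJ : ∀ n, y n = J n + cseq n • v n)
    (hy : ∀ n, y (n + 1) = lam n • u + gam n • y n + del n • J n)
    (hp : p ∈ zeroSet A) (hu : ‖u - p‖ ≤ D / 2) (hy0 : ‖y 0 - p‖ ≤ D) (n : ℕ) :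
    ‖y n - p‖ ≤ D := by
  have hD : 0 ≤ D := (norm_nonneg _).trans hy0
  induction n with
  | zero => exact hy0
  | succ n ih =>
    have hJp := (hA.resolvent_norm_sub_zero_le (hcseq n) (hv n) (hJ n) hp).trans ih
    have h1 : y (n + 1) - p = lam n • (u - p) + gam n • (y n - p) + del n • (J n - p) := by
      have : p = lam n • p + gam n • p + del n • p := by
        rw [← add_smul, ← add_smul, hsum, one_smul]
      rw [hy]
      nth_rw 1 [this]
      simp only [smul_sub]
      abel
    have h2 := norm_sq_convex_comb_le (a := u - p) (b := y n - p) (d := J n - p)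
      (hlam n).1.le (hgam n).1 (hdel n).1.le (hsum n)
    rw [← h1] at h2
    have a1 : ‖u - p‖ ^ 2 ≤ D ^ 2 := pow_le_pow_left₀ (norm_nonneg _) (by linarith) 2
    have a2 : ‖y n - p‖ ^ 2 ≤ D ^ 2 := pow_le_pow_left₀ (norm_nonneg _) ih 2
    have a3 : ‖J n - p‖ ^ 2 ≤ D ^ 2 := pow_le_pow_left₀ (norm_nonneg _) hJp 2
    have b1 := mul_le_mul_of_nonneg_left a1 (hlam n).1.le
    have b2 := mul_le_mul_of_nonneg_left a2 (hgam n).1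
    have b3 := mul_le_mul_of_nonneg_left a3 (hdel n).1.le
    have b4 : lam n * D ^ 2 + gam n * D ^ 2 + del n * D ^ 2 = D ^ 2 := by
      rw [← add_mul, ← add_mul, hsum, one_mul]
    exact le_of_sq_le_sq (by linarith) hD

lemma IsMonotoneOp.isPPARecursion (hA : IsMonotoneOp A)
    (hcseq : ∀ n, 0 < cseq n) (hlam : ∀ n, lam n ∈ Set.Ioo (0 : ℝ) 1)
    (hdel : ∀ n, del n ∈ Set.Ioo (0 : ℝ) 1) (hgam : ∀ n, gam n ∈ Set.Ico (0 : ℝ) 1)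
    (hsum : ∀ n, lam n + gam n + del n = 1) (hv : ∀ n, v n ∈ A (J n))
    (hJ : ∀ n, y n = J n + cseq n • v n)
    (hy : ∀ n, y (n + 1) = lam n • u + gam n • y n + del n • J n)
    (hp : p ∈ zeroSet A) (hu : ‖u - p‖ ≤ D / 2) (hyp : ∀ n, ‖y n - p‖ ≤ D)
    {z a : H} (ha : a ∈ A z) (huz : ‖u - z‖ ≤ D / 2) (hzp : ‖z - p‖ ≤ D / 2) :
    IsPPARecursion D (fun n => ‖y n - z‖ ^ 2) lam del (fun n => ‖J n - y n‖)
      (fun n => inner ℝ (u - z) (y n - z)) (fun n => cseq n * ‖a‖) := by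
  have hD : 0 ≤ D := (norm_nonneg _).trans (hyp 0)
  have hJp : ∀ n, ‖J n - p‖ ≤ D := fun n =>
    (hA.resolvent_norm_sub_zero_le (hcseq n) (hv n) (hJ n) hp).trans (hyp n)
  have he : ∀ n, 0 ≤ cseq n * ‖a‖ := fun n => mul_nonneg (hcseq n).le (norm_nonneg _)
  -- Firm nonexpansivity at z up to the error from a ≠ 0; the fields `residual`, `step` and
  -- `residual_sq` rest on it.
  have hfirm : ∀ n, ‖J n - z‖ ^ 2 + ‖J n - y n‖ ^ 2 ≤
      ‖y n - z‖ ^ 2 + 3 * D * (cseq n * ‖a‖) := by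
    intro n
    have h1 := hA.resolvent_norm_sq_le (hcseq n) (hv n) (hJ n) ha
    have h2 := norm_sub_le_of_norm_sub_le (hJp n) hzp
    have h3 := mul_le_mul_of_nonneg_left h2 (he n)
    linarith
  have hyz : ∀ n, y (n + 1) - z = lam n • (u - z) + gam n • (y n - z) + del n • (J n - z) := by
    intro n
    have : z = lam n • z + gam n • z + del n • z := by
      rw [← add_smul, ← add_smul, hsum, one_smul]
    rw [hy]
    nth_rw 1 [this]
    simp only [smul_sub]
    abel
  have hE : ∀ n, del n * (3 * D * (cseq n * ‖a‖)) ≤ 3 * D * (cseq n * ‖a‖) := fun n =>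
    mul_le_of_le_one_left (mul_nonneg (by positivity) (he n)) (hdel n).2.le
  refine ⟨fun i => sq_nonneg _, fun i => ?_, fun i => norm_nonneg _, fun i => (hlam i).1.le,
    fun i => (hlam i).2.le, fun i => ?_, fun i => ?_, fun i => ?_, fun i => ?_⟩
  · have h1 := pow_le_pow_left₀ (norm_nonneg _) (norm_sub_le_of_norm_sub_le (hyp i) hzp) 2
    nlinarith [sq_nonneg D]
  · have h1 := norm_sq_convex_comb_le (a := u - z) (b := y i - z) (d := J i - z)
      (hlam i).1.le (hgam i).1 (hdel i).1.le (hsum i)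
    rw [← hyz] at h1
    have h2 := pow_le_pow_left₀ (norm_nonneg _) huz 2
    have h3 := mul_le_mul_of_nonneg_left h2 (hlam i).1.le
    have h4 := mul_le_mul_of_nonneg_left (hfirm i) (hdel i).1.le
    have h5 : (gam i + del i) * ‖y i - z‖ ^ 2 ≤ ‖y i - z‖ ^ 2 :=
      mul_le_of_le_one_left (sq_nonneg _) (by linarith [hsum i, (hlam i).1])
    linarith [hE i]
  · have h1 := norm_add_sq_le_norm_sq_add (lam i • (u - z))
      (gam i • (y i - z) + del i • (J i - z))
    rw [← add_assoc, ← hyz, real_inner_smul_left] at h1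
    have h2 := norm_sq_smul_add_smul_le (b := y i - z) (d := J i - z) (hgam i).1 (hdel i).1.le
    have h4 : del i * ‖J i - z‖ ^ 2 ≤ del i * ‖y i - z‖ ^ 2 + 3 * D * (cseq i * ‖a‖) := by
      have := mul_le_mul_of_nonneg_left (hfirm i) (hdel i).1.le
      linarith [hE i, mul_nonneg (hdel i).1.le (sq_nonneg ‖J i - y i‖)]
    have hgd : gam i + del i = 1 - lam i := by linarith [hsum i]
    have h5 : (gam i + del i) * (gam i * ‖y i - z‖ ^ 2 + del i * ‖J i - z‖ ^ 2) ≤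
        (1 - lam i) * ((1 - lam i) * ‖y i - z‖ ^ 2 + 3 * D * (cseq i * ‖a‖)) := by
      rw [← hgd]
      refine mul_le_mul_of_nonneg_left ?_ (by linarith [(hgam i).1, (hdel i).1])
      linarith
    have h6 : 0 ≤ 3 * D * (cseq i * ‖a‖) := mul_nonneg (by positivity) (he i)
    have h7 : 0 ≤ 1 - lam i := by linarith [(hlam i).2]
    have h8 : (1 - lam i) * ((1 - lam i) * ‖y i - z‖ ^ 2) ≤ (1 - lam i) * ‖y i - z‖ ^ 2 :=
      mul_le_of_le_one_left (mul_nonneg h7 (sq_nonneg _)) (by linarith [(hlam i).1])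
    have h9 := mul_nonneg (hlam i).1.le h6
    linarith
  · have h1 : y (i + 1) - z = (y i - z) + (lam i • (u - y i) + del i • (J i - y i)) := by
      have : y i = lam i • y i + gam i • y i + del i • y i := by
        rw [← add_smul, ← add_smul, hsum, one_smul]
      rw [hy]
      nth_rw 2 [this]
      simp only [smul_sub]
      abel
    have h2 : ‖u - y i‖ ≤ 3 * D / 2 := by
      rw [norm_sub_rev]
      exact norm_sub_le_of_norm_sub_le (hyp i) hu
    have h3 : ‖lam i • (u - y i) + del i • (J i - y i)‖ ≤
        lam i * (3 * D / 2) + ‖J i - y i‖ := by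
      refine (norm_add_le _ _).trans (add_le_add ?_ ?_)
      · rw [norm_smul, Real.norm_eq_abs, abs_of_pos (hlam i).1]
        exact mul_le_mul_of_nonneg_left h2 (hlam i).1.le
      · rw [norm_smul, Real.norm_eq_abs, abs_of_pos (hdel i).1]
        exact mul_le_of_le_one_left (norm_nonneg _) (hdel i).2.le
    change inner ℝ (u - z) (y (i + 1) - z) ≤ _
    rw [h1, inner_add_right]
    have h4 := (real_inner_le_norm (u - z) (lam i • (u - y i) + del i • (J i - y i))).trans
      (mul_le_mul huz h3 (norm_nonneg _) (by linarith))
    linarith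
  · linarith [hfirm i, sq_nonneg ‖J i - z‖]

end Iteration

/-! ### Assembly of the bounds -/

/-- Metastable smallness of the residuals, with the bound `mu`. -/
theorem exists_residual_window {H : Type*} [NormedAddCommGroup H] [InnerProductSpace ℝ H]
    [CompleteSpace H] {A : H → Set H} (hA : IsMaximalMonotoneOp A)
    {u p : H} {cseq lam gam del : ℕ → ℝ} {y : ℕ → H} {c D : ℕ} {h ℓ L C f : ℕ → ℕ}
    (hcseq : ∀ n, 0 < cseq n)
    (hlam : ∀ n, lam n ∈ Set.Ioo (0 : ℝ) 1)
    (hdel : ∀ n, del n ∈ Set.Ioo (0 : ℝ) 1)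
    (hgam : ∀ n, gam n ∈ Set.Ico (0 : ℝ) 1)
    (hsum : ∀ n, lam n + gam n + del n = 1)
    (hy : ∀ n, y (n + 1) =
      lam n • u + gam n • y n + del n • resolventFun A (cseq n) (y n))
    (hc : 0 < c) (hmono : Monotone h) (hℓmono : Monotone ℓ) (hLmono : Monotone L)
    (hpos : ∀ n, 0 < h n)
    (hQ1 : ∀ n, 1 / (h n : ℝ) ≤ lam n)
    (hQ2 : ∀ k n : ℕ, ℓ k ≤ n → lam n ≤ 1 / ((k : ℝ) + 1))
    (hQ3 : ∀ k : ℕ, (k : ℝ) ≤ ∑ i ∈ Finset.Icc 1 (L k), lam i)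
    (hQ4 : ∀ n, 1 / (c : ℝ) ≤ min (cseq n) (del n ^ 2))
    (hCmono : Monotone C) (hC : ∀ n, cseq n ≤ (C n : ℝ)) (hD : 0 < D)
    (hp : p ∈ zeroSet A) (hDp : max (2 * ‖u - p‖) ‖y 0 - p‖ ≤ (D : ℝ))
    (k : ℕ) (hf : Monotone f) :
    ∃ n ≤ mu c C ℓ L D h k f, ∀ i ∈ Set.Icc n (f n),
      ‖resolventFun A (cseq i) (y i) - y i‖ ^ 2 ≤ 2 / ((k : ℝ) + 1) := by
  have hc' : (0 : ℝ) < c := by exact_mod_cast hc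
  have hu : ‖u - p‖ ≤ D / 2 := by linarith [(le_max_left _ _).trans hDp]
  have hres := fun n => hA.resolventFun_mem ⟨(p, 0), hp⟩ (hcseq n) (y n)
  choose v hv hJ using hres
  have hyp := hA.1.iterate_norm_sub_le hcseq hlam hdel hgam hsum hv hJ hy hp hu
    ((le_max_right _ _).trans hDp)
  obtain ⟨N, hN, z, a, ha, haN, huz, hzp, hproj⟩ := exists_approx_projection hA hp hc hD hu
    (32 * (k + 1) ^ 2 - 1) (Xi k f c C ℓ L D h)
  have hcast : ((32 * (k + 1) ^ 2 - 1 : ℕ) : ℝ) + 1 = 32 * ((k : ℝ) + 1) ^ 2 := by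
    have : 32 * (k + 1) ^ 2 - 1 + 1 = 32 * (k + 1) ^ 2 :=
      Nat.sub_add_cancel (Nat.succ_le_of_lt (by positivity))
    exact_mod_cast this
  rw [hcast] at hproj
  have hR := hA.1.isPPARecursion hcseq hlam hdel hgam hsum hv hJ hy hp hu hyp ha huz hzp
  obtain ⟨n, hn, hwin⟩ := hR.exists_window (N := N) (k := k) (ℓ := ℓ) (C := C) (f := f) hc hD
    hmono hLmono hf hpos hQ1 hQ2 hQ3
    (fun i => (hQ4 i).trans ((min_le_right _ _).trans
      (pow_le_of_le_one (hdel i).1.le (hdel i).2.le two_ne_zero)))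
    (fun i hi => hproj (y i) _ (v i) (cseq i) (hv i) (hJ i) ((hQ4 i).trans (min_le_left _ _))
      (hyp i) ((hA.1.resolvent_norm_sub_zero_le (hcseq i) (hv i) (hJ i) hp).trans (hyp i))
      (by rwa [norm_sub_rev]))
    (by
      -- `zeta` is designed for this: ‖a‖ ≤ c / (Ξ(N) + 1) and c_i ≤ C n cancel to 1 / (j + 1).
      intro j n i hin hz
      have hCn : (0 : ℝ) < C n := (hcseq n).trans_le (hC n)
      have hCn' : 0 < C n := by exact_mod_cast hCn
      have h1 : c * (j + 1) * C n ≤ Xi k f c C ℓ L D h N + 1 := Nat.sub_le_iff_le_add.1 hz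
      have h2 : (c : ℝ) * ((j : ℝ) + 1) * C n ≤ (Xi k f c C ℓ L D h N : ℝ) + 1 := by
        exact_mod_cast h1
      have h3 : cseq i ≤ C n := (hC i).trans (by exact_mod_cast hCmono hin)
      calc cseq i * ‖a‖ ≤ C n * (c / ((c : ℝ) * ((j : ℝ) + 1) * C n)) := by
            refine mul_le_mul h3 (haN.trans ?_) (norm_nonneg _) hCn.le
            gcongr
        _ = 1 / ((j : ℝ) + 1) := by field_simp)
  exact ⟨n, hn.trans (max_le_mu hℓmono hLmono hf hN), hwin⟩

end MultiPPA

theorem mainTheorem5 {H : Type*} [NormedAddCommGroup H] [InnerProductSpace ℝ H] [CompleteSpace H]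
    (A : H → Set H) (hA : MultiPPA.IsMaximalMonotoneOp A)
    -- the parameters of the iteration
    (u : H) (cseq lam gam del : ℕ → ℝ)
    (hcseq : ∀ n, 0 < cseq n)
    (hlam : ∀ n, lam n ∈ Set.Ioo (0 : ℝ) 1)
    (hdel : ∀ n, del n ∈ Set.Ioo (0 : ℝ) 1)
    (hgam : ∀ n, gam n ∈ Set.Ico (0 : ℝ) 1)
    (hsum : ∀ n, lam n + gam n + del n = 1)
    -- the exact multi-parameter proximal point algorithm
    (y : ℕ → H)
    (hy : ∀ n, y (n + 1) =
      lam n • u + gam n • y n + del n • MultiPPA.resolventFun A (cseq n) (y n))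
    -- the quantitative data
    (c : ℕ) (hc : 0 < c) (h ℓ L : ℕ → ℕ)
    (hmono : Monotone h) (hℓmono : Monotone ℓ) (hLmono : Monotone L)
    (hpos : ∀ n, 0 < h n)
    (hQ1 : ∀ n, 1 / (h n : ℝ) ≤ lam n)
    (hQ2 : ∀ k n : ℕ, ℓ k ≤ n → lam n ≤ 1 / ((k : ℝ) + 1))
    (hQ3 : ∀ k : ℕ, (k : ℝ) ≤ ∑ i ∈ Finset.Icc 1 (L k), lam i)
    (hQ4 : ∀ n, 1 / (c : ℝ) ≤ min (cseq n) (del n ^ 2))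
    (C : ℕ → ℕ) (hCmono : Monotone C) (hC : ∀ n, cseq n ≤ (C n : ℝ))
    (D : ℕ) (hD : 0 < D)
    (hDp : ∃ p ∈ MultiPPA.zeroSet A, max (2 * ‖u - p‖) ‖y 0 - p‖ ≤ (D : ℝ))
    (k : ℕ) (f : ℕ → ℕ) (hf : Monotone f) :
    (∃ n ≤ MultiPPA.muTilde c C ℓ L D h k f, ∀ i ∈ Set.Icc n (f n),
      ‖MultiPPA.resolventFun A (cseq i) (y i) - y i‖ ≤ 1 / ((k : ℝ) + 1)) ∧
    (∃ n ≤ MultiPPA.muTilde c C ℓ L D h (2 * k + 1) f, ∀ i ∈ Set.Icc n (f n),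
      ‖MultiPPA.resolventFun A (1 / (c : ℝ)) (y i) - y i‖ ≤ 1 / ((k : ℝ) + 1)) := by
  obtain ⟨p, hp, hDp⟩ := hDp
  have hc' : (0 : ℝ) < c := by exact_mod_cast hc
  have main : ∀ k : ℕ, ∃ n ≤ MultiPPA.muTilde c C ℓ L D h k f, ∀ i ∈ Set.Icc n (f n),
      ‖MultiPPA.resolventFun A (cseq i) (y i) - y i‖ ≤ 1 / ((k : ℝ) + 1) := by
    intro k
    set l := ℓ (4 * c * D * (k + 1) - 1) with hl
    set F : ℕ → ℕ := fun m => MultiPPA.fCheck c ℓ D k f m + 1 with hF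
    have hFmono : Monotone F := fun a b hab =>
      Nat.succ_le_succ (hf (max_le_max_right l hab))
    obtain ⟨n, hn, hwin⟩ := MultiPPA.exists_residual_window hA hcseq hlam hdel hgam hsum hy hc
      hmono hℓmono hLmono hpos hQ1 hQ2 hQ3 hQ4 hCmono hC hD hp hDp
      (16 * c ^ 2 * (k + 1) ^ 2 - 1) hFmono
    -- Since F n = f (max n l) + 1, the window of max n l under f lies inside that of n under F.
    refine ⟨max n l, max_le_max_right l hn, fun i hi => ?_⟩
    have h1 := hwin i ⟨(le_max_left _ _).trans hi.1, hi.2.trans (Nat.le_succ _)⟩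
    have hcast : ((16 * c ^ 2 * (k + 1) ^ 2 - 1 : ℕ) : ℝ) + 1
        = 16 * (c : ℝ) ^ 2 * ((k : ℝ) + 1) ^ 2 := by
      have : 16 * c ^ 2 * (k + 1) ^ 2 - 1 + 1 = 16 * c ^ 2 * (k + 1) ^ 2 :=
        Nat.sub_add_cancel (Nat.succ_le_of_lt (by positivity))
      exact_mod_cast this
    rw [hcast] at h1
    refine le_of_sq_le_sq (h1.trans ?_) (by positivity)
    rw [one_div_pow, div_le_div_iff₀ (by positivity) (by positivity)]
    have hc1 : (1 : ℝ) ≤ (c : ℝ) ^ 2 := one_le_pow₀ (by exact_mod_cast hc)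
    nlinarith [mul_le_mul_of_nonneg_right hc1 (sq_nonneg ((k : ℝ) + 1)),
      sq_nonneg ((k : ℝ) + 1)]
  refine ⟨main k, ?_⟩
  obtain ⟨n, hn, hwin⟩ := main (2 * k + 1)
  refine ⟨n, hn, fun i hi => ?_⟩
  obtain ⟨v, hv, hJ⟩ := hA.resolventFun_mem ⟨(p, 0), hp⟩ (hcseq i) (y i)
  obtain ⟨w, hw, hJ'⟩ := hA.resolventFun_mem ⟨(p, 0), hp⟩ (one_div_pos.2 hc') (y i)
  -- As 1 / c ≤ c_i, the residual of J is at most that of J_{c_i}, which is already at most 1 / (2k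
  -- + 2).
  refine (hA.1.residual_mono (one_div_pos.2 hc') ((hQ4 i).trans (min_le_left _ _)) hw hJ' hv
    hJ).trans ((hwin i hi).trans (one_div_le_one_div_of_le (by positivity) ?_))
  push_cast
  linarith [Nat.cast_nonneg (α := ℝ) k]
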